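/- All graphs are finite and simple; $\overline{G}$ denotes the complement of $G$ and $\chi$ the chromatic number. A circular-arc (CA) graph is the intersection graph of a family of closed arcs of a circle, none of which is empty, a single point or the whole circle. A graph is co-bipartite if its complement is bipartite. A box representation of $G$ of dimension $k$ is a family of interval graphs $I_1,\dots,I_k$ on the vertex set $V(G)$ with $E(G)=E(I_1)\cap\dots\cap E(I_k)$ (for $k=0$ the intersection is the complete graph). The boxicity $\mathrm{box}(G)$ is the minimum dimension of a box representation of $G$, and a box representation of that dimension is called optimal. For a graph $H$, let $H^*$ be the graph with vertex set $E(H)$ in which two edges $wx$ and $yz$ of $H$ are adjacent if and only if $\{w,x,y,z\}$ induces a $2K_2$ in $H$. **Theorem.** Let $G=(V,E)$ be a co-bipartite CA graph and let $H=\overline{G}$. Then the following hold. 1. $\mathrm{box}(G)=\chi(H^*)$. 2. Let $k=\chi(H^*)$, let $C_1,\dots,C_k$ be the colour classes of a proper colouring of $H^*$ with $k$ colours, and for each $i$ let $M_i\supseteq C_i$ be any maximal independent set of $H^*$ that contains $C_i$. Let $G_i$ be the complement of the graph $(V,M_i)$. Then $G_1,\dots,G_k$ are interval supergraphs of $G$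 and form an optimal box representation of $G$. 3. $\mathrm{box}(G)$ and an optimal box representation of $G$ can be computed in polynomial time: there are algorithms (random access machine programs in which additions, subtractions, memory accesses and tests cost one step each) and polynomials $p$ such that, given the adjacency matrix of any co-bipartite CA graph $G$ on $n$ vertices, the algorithm halts after at most $p(n)$ steps and outputs, respectively, the number $\mathrm{box}(G)$, and the number $k=\mathrm{box}(G)$ together with interval models (the end points of the intervals) of the $k$ interval graphs of an optimal box representation of $G$. -/

import Mathlib

/-! ### Interval graphs, circular-arc graphs, boxicity -/

namespace SimpleGraph

/-- The intersection graph of the closed real intervals `[l v, r v]`. -/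
def intervalModelGraph {V : Type*} (l r : V → ℝ) : SimpleGraph V where
  Adj u v := u ≠ v ∧ (Set.Icc (l u) (r u) ∩ Set.Icc (l v) (r v)).Nonempty
  symm := ⟨fun _ _ h => ⟨h.1.symm, by rw [Set.inter_comm]; exact h.2⟩⟩
  loopless := ⟨fun _ h => h.1 rfl⟩

/-- Interval graphs: intersection graphs of closed intervals of the real line,
none of which is empty or a single point. -/
def IsIntervalGraph {V : Type*} (G : SimpleGraph V) : Prop :=
  ∃ l r : V → ℝ, (∀ v, l v < r v) ∧ G = intervalModelGraph l r

/-- The closed arc of the circle `ℝ / ℤ` that starts at (the class of) `s` and has length `len`,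
traversed in the positive direction. -/
def circleArc (s len : ℝ) : Set (AddCircle (1 : ℝ)) :=
  (fun x : ℝ => (x : AddCircle (1 : ℝ))) '' Set.Icc s (s + len)

/-- Circular-arc graphs: intersection graphs of closed arcs of a circle, none of which is empty, a
single point or the whole circle. -/
def IsCircularArcGraph {V : Type*} (G : SimpleGraph V) : Prop :=
  ∃ s len : V → ℝ, (∀ v, 0 < len v ∧ len v < 1) ∧
    ∀ u v, u ≠ v →
      (G.Adj u v ↔ (circleArc (s u) (len u) ∩ circleArc (s v) (len v)).Nonempty)

/-- A graph is co-bipartite if its complement is bipartite. -/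
def IsCoBipartite {V : Type*} (G : SimpleGraph V) : Prop :=
  Gᶜ.IsBipartite

/-- A box representation of `G` of dimension `k`: interval graphs `I 0, …, I (k - 1)` on the vertex
set of `G` whose intersection is `G`. (For `k = 0` the intersection is the complete graph.) -/
def IsBoxRepresentation {V : Type*} (G : SimpleGraph V) {k : ℕ} (I : Fin k → SimpleGraph V) :
    Prop :=
  (∀ i, (I i).IsIntervalGraph) ∧ ⨅ i, I i = G

/-- The boxicity: the minimum dimension of a box representation (`⊤` if there is none; on a finite
vertex set there always is one). -/
noncomputable def boxicity {V : Type*} (G : SimpleGraph V) : ℕ∞ :=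
  ⨅ k ∈ {k : ℕ | ∃ I : Fin k → SimpleGraph V, G.IsBoxRepresentation I}, (k : ℕ∞)

/-- A box representation of minimum dimension. -/
def IsOptimalBoxRepresentation {V : Type*} (G : SimpleGraph V) {k : ℕ}
    (I : Fin k → SimpleGraph V) : Prop :=
  G.IsBoxRepresentation I ∧ (k : ℕ∞) = G.boxicity

/-- The auxiliary graph `H*`: its vertices are the edges of `H`, and two edges `wx`, `yz` of `H` are
adjacent if and only if `{w, x, y, z}` induces a `2K₂` in `H`, that is, the two edges
have no common end point and no edge of `H` joins an end point of one to an end point of the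
other. -/
def auxGraph {V : Type*} (H : SimpleGraph V) : SimpleGraph H.edgeSet where
  Adj e f := ∀ u ∈ (e : Sym2 V), ∀ v ∈ (f : Sym2 V), u ≠ v ∧ ¬ H.Adj u v
  symm := ⟨fun _ _ h u hu v hv => ⟨(h v hv u hu).1.symm, fun a => (h v hv u hu).2 a.symm⟩⟩
  loopless := ⟨fun e h => (h _ (Sym2.out_fst_mem e.1) _ (Sym2.out_fst_mem e.1)).1 rfl⟩

/-- For a set `S` of edges of `H`, the complement of the graph `(V, S)`. -/
def complOfEdges {V : Type*} (H : SimpleGraph V) (S : Set H.edgeSet) : SimpleGraph V :=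
  (fromEdgeSet ((fun e : H.edgeSet => (e : Sym2 V)) '' S))ᶜ

end SimpleGraph

/-! ### Random access machines with unit-cost addition and subtraction -/

namespace Ram

/-- A machine state: registers, which a program addresses directly, and a memory, which it
addresses through the contents of registers. All cells hold natural numbers. -/
structure State where
  reg : ℕ → ℕ
  mem : ℕ → ℕ

/-- Programs. A program is a finite object and so mentions only finitely many registers. There is no
multiplication: with unit cost only numbers of polynomially many bits can arise in
polynomially many steps. -/
inductive Prog : Type
  /-- do nothing -/
  | skip : Prog
  /-- `reg x := c` -/
  | const (x c : ℕ) : Prog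
  /-- `reg x := reg y + reg z` -/
  | add (x y z : ℕ) : Prog
  /-- `reg x := reg y - reg z` (truncated at zero) -/
  | sub (x y z : ℕ) : Prog
  /-- `reg x := mem (reg y)` -/
  | load (x y : ℕ) : Prog
  /-- `mem (reg x) := reg y` -/
  | store (x y : ℕ) : Prog
  /-- first `p`, then `q` -/
  | seq (p q : Prog) : Prog
  /-- if `reg x` is nonzero then `p`, else `q` -/
  | ite (x : ℕ) (p q : Prog) : Prog
  /-- as long as `reg x` is nonzero, repeat `p` -/
  | loop (x : ℕ) (p : Prog) : Prog

/-- `Exec p s t s'`: the program `p`, started in state `s`, halts in state `s'` after exactly `t`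
steps. Every elementary instruction and every test costs one step. -/
inductive Exec : Prog → State → ℕ → State → Prop
  | skip (s : State) : Exec .skip s 1 s
  | const (x c : ℕ) (s : State) :
      Exec (.const x c) s 1 { s with reg := Function.update s.reg x c }
  | add (x y z : ℕ) (s : State) :
      Exec (.add x y z) s 1 { s with reg := Function.update s.reg x (s.reg y + s.reg z) }
  | sub (x y z : ℕ) (s : State) :
      Exec (.sub x y z) s 1 { s with reg := Function.update s.reg x (s.reg y - s.reg z) }
  | load (x y : ℕ) (s : State) :
      Exec (.load x y) s 1 { s with reg := Function.update s.reg x (s.mem (s.reg y)) }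
  | store (x y : ℕ) (s : State) :
      Exec (.store x y) s 1 { s with mem := Function.update s.mem (s.reg x) (s.reg y) }
  | seq {p q : Prog} {s s' s'' : State} {t t' : ℕ} :
      Exec p s t s' → Exec q s' t' s'' → Exec (.seq p q) s (t + t') s''
  | iteTrue {x : ℕ} {p q : Prog} {s s' : State} {t : ℕ} :
      s.reg x ≠ 0 → Exec p s t s' → Exec (.ite x p q) s (t + 1) s'
  | iteFalse {x : ℕ} {p q : Prog} {s s' : State} {t : ℕ} :
      s.reg x = 0 → Exec q s t s' → Exec (.ite x p q) s (t + 1) s'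
  | loopDone {x : ℕ} {p : Prog} {s : State} :
      s.reg x = 0 → Exec (.loop x p) s 1 s
  | loopStep {x : ℕ} {p : Prog} {s s' s'' : State} {t t' : ℕ} :
      s.reg x ≠ 0 → Exec p s t s' → Exec (.loop x p) s' t' s'' →
        Exec (.loop x p) s (t + t' + 1) s''

open Classical in
/-- The input state for a graph on `{0, …, n - 1}`: register `0` holds `n`, the memory holds the
adjacency matrix row by row, and every other cell is zero. -/
noncomputable def graphInput {n : ℕ} (G : SimpleGraph (Fin n)) : State where
  reg x := if x = 0 then n else 0
  mem a := if ∃ u v : Fin n, G.Adj u v ∧ a = (u : ℕ) * n + (v : ℕ) then 1 else 0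

/-- One program, in a number of steps bounded by one polynomial in the number `n` of vertices, turns
every graph `G` of the class `C`, given as input, into a final state that is a correct
output `R n G` for `G`. -/
def PolyTimeComputable (C : ∀ n : ℕ, SimpleGraph (Fin n) → Prop)
    (R : ∀ n : ℕ, SimpleGraph (Fin n) → State → Prop) : Prop :=
  ∃ (P : Prog) (p : Polynomial ℕ), ∀ (n : ℕ) (G : SimpleGraph (Fin n)), C n G →
    ∃ (t : ℕ) (s : State), Exec P (graphInput G) t s ∧ t ≤ p.eval n ∧ R n G s

/-- The final state holds the number `box(G)`, in register `0`. -/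
def OutputsBoxicity (n : ℕ) (G : SimpleGraph (Fin n)) (s : State) : Prop :=
  (s.reg 0 : ℕ∞) = G.boxicity

/-- The left end point that the final state holds for vertex `v` in the `i`-th interval model. -/
def leftEnd (n : ℕ) (s : State) (i v : ℕ) : ℝ := (s.mem (2 * (i * n + v)) : ℝ)

/-- The right end point that the final state holds for vertex `v` in the `i`-th interval model. -/
def rightEnd (n : ℕ) (s : State) (i v : ℕ) : ℝ := (s.mem (2 * (i * n + v) + 1) : ℝ)

/-- The final state holds an optimal box representation of `G`: register `0` holds its dimension
`k`, and the memory holds, for each `i < k` and each vertex `v`, the end points of the interval of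
`v` in a model of the `i`-th interval graph. -/
def OutputsOptimalBoxRepresentation (n : ℕ) (G : SimpleGraph (Fin n)) (s : State) : Prop :=
  (∀ (i : Fin (s.reg 0)) (v : Fin n), leftEnd n s i v < rightEnd n s i v) ∧
    G.IsOptimalBoxRepresentation (fun i : Fin (s.reg 0) =>
      SimpleGraph.intervalModelGraph (fun v : Fin n => leftEnd n s i v)
        (fun v : Fin n => rightEnd n s i v))

end Ram

/-!
Throughout, `G` is a co-bipartite circular-arc graph and `H` its complement, which is bipartite. An
induced `2K₂` of `H` is an induced four-cycle of `G` (`SimpleGraph.InducesC4`).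

*Lower bound.* An interval graph has no induced four-cycle, so the edges of `H` that are missing
from one graph of a box representation form an independent set of `H*`
(`SimpleGraph.IsBoxRepresentation.colorable`).

*Upper bound.* The four arcs of an induced four-cycle of `G` go round the circle in one of two
directions (`SimpleGraph.IsCircularArcGraph.exists_rotation`). The directions exclude an induced
six-cycle of `H` (`SimpleGraph.not_inducesC6`), and from this it follows that a maximal independent
set of `H*` is the edge set of a chain graph (`SimpleGraph.IsMaxIndepRel.chain`). The complement of
a chain graph on a bipartition is an interval graph, with explicit end points
(`SimpleGraph.intervalModelGraph_chain_adj`). Hence the complements of maximal independent sets that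
cover `H*` form a box representation.

*Computation.* The directions also orient the edges of `H*`, and this orientation respects the
forcing relation of transitive orientations (`SimpleGraph.orientable_auxCode`). So no implication
class of `H*` contains an edge in both directions, and the classes can be oriented
lexicographically: the class that contains the smallest pair wins over its reversal. This
orientation is transitive (`Comparability.Orientable.trans`), so that `H*` is a comparability graph,
and colouring every edge of `H` with its height, that is, with the length of a longest chain below
it, is optimal: a longest chain is a clique (`SimpleGraph.numLevels_eq_chromaticNumber`). The colour
classes are extended greedily to maximal independent sets, whose interval models form an optimal box
representation (`SimpleGraph.isOptimalBoxRepresentation_levels`).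

All these notions are definable, with quantifiers bounded by fixed powers of `n`, from tables that
are filled one after the other. Formulas are represented by the terms `Ram.Term`, which random
access machine programs evaluate in polynomial time (`Ram.Term.exists_computes`,
`Ram.exists_prog_of_fills`); `Ram.Boxicity.fills_spec` says that the tables hold what they are meant
to.
-/

/-! ### Induced four-cycles -/

namespace SimpleGraph

variable {V : Type*}

/-- The vertices `a`, `a'`, `b`, `b'`, in this cyclic order, induce a four-cycle in `G`;
equivalently `ab` and `a'b'` form an induced `2K₂` of the complement. -/
structure InducesC4 (G : SimpleGraph V) (a b a' b' : V) : Prop where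
  ne : a ≠ b
  not_adj : ¬ G.Adj a b
  ne' : a' ≠ b'
  not_adj' : ¬ G.Adj a' b'
  aa' : G.Adj a a'
  ab' : G.Adj a b'
  ba' : G.Adj b a'
  bb' : G.Adj b b'

namespace InducesC4

variable {G : SimpleGraph V} {a b a' b' : V}

lemma symm (h : G.InducesC4 a b a' b') : G.InducesC4 a' b' a b :=
  ⟨h.ne', h.not_adj', h.ne, h.not_adj, h.aa'.symm, h.ba'.symm, h.ab'.symm, h.bb'.symm⟩

lemma flip_left (h : G.InducesC4 a b a' b') : G.InducesC4 b a a' b' :=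
  ⟨h.ne.symm, fun e => h.not_adj e.symm, h.ne', h.not_adj', h.ba', h.bb', h.aa', h.ab'⟩

lemma flip_right (h : G.InducesC4 a b a' b') : G.InducesC4 a b b' a' :=
  h.symm.flip_left.symm

end InducesC4

/-! ### Rotation of four-cycles in circular-arc graphs -/

/-- Membership in an arc, written with integer translates of real representatives. -/
lemma coe_mem_circleArc {t s len : ℝ} :
    (t : AddCircle (1 : ℝ)) ∈ circleArc s len ↔ ∃ k : ℤ, s ≤ t + k ∧ t + k ≤ s + len := by
  simp only [circleArc, Set.mem_image, Set.mem_Icc]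
  constructor
  · rintro ⟨x, ⟨h1, h2⟩, hx⟩
    obtain ⟨k, hk⟩ := AddCircle.coe_eq_zero_iff (1 : ℝ) |>.1
      (show ((x - t : ℝ) : AddCircle (1 : ℝ)) = 0 by rw [AddCircle.coe_sub, hx, sub_self])
    refine ⟨k, ?_, ?_⟩ <;> simp at hk <;> linarith
  · rintro ⟨k, h1, h2⟩
    refine ⟨t + k, ⟨h1, h2⟩, ?_⟩
    have : ((k : ℝ) : AddCircle (1 : ℝ)) = 0 :=
      (AddCircle.coe_eq_zero_iff (1 : ℝ)).2 ⟨k, by simp⟩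
    rw [AddCircle.coe_add, this, add_zero]

/-- Two closed arcs meet if and only if one of them contains the starting point of the other. -/
lemma circleArc_inter_nonempty {s l s' l' : ℝ} (hl : 0 ≤ l) (hl' : 0 ≤ l') :
    (circleArc s l ∩ circleArc s' l').Nonempty ↔
      (s : AddCircle (1 : ℝ)) ∈ circleArc s' l' ∨ (s' : AddCircle (1 : ℝ)) ∈ circleArc s l := by
  constructor
  · rintro ⟨_, ⟨x, ⟨hx1, hx2⟩, rfl⟩, hy⟩
    obtain ⟨k, hk1, hk2⟩ := coe_mem_circleArc.1 hy
    rcases le_total (x - s) (x + k - s') with h | h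
    · exact Or.inl (coe_mem_circleArc.2 ⟨k, by linarith, by linarith⟩)
    · exact Or.inr (coe_mem_circleArc.2 ⟨-k, by push_cast; linarith, by push_cast; linarith⟩)
  · rintro (h | h)
    · exact ⟨_, ⟨s, ⟨le_rfl, by linarith⟩, rfl⟩, h⟩
    · exact ⟨_, h, ⟨s', ⟨le_rfl, by linarith⟩, rfl⟩⟩

/-- The position `p` on the circle, cut open at the point `0`, lies in the arc of length `l` that
starts at the position `q`. -/
def PosIn (p q l : ℝ) : Prop := (q ≤ p ∧ p ≤ q + l) ∨ (p < q ∧ p + 1 ≤ q + l)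

/-- Any point `c` of the circle can be taken as the point at which it is cut open. -/
lemma coe_mem_circleArc_iff_posIn (c t s : ℝ) {l : ℝ} (hl : l < 1) :
    (t : AddCircle (1 : ℝ)) ∈ circleArc s l ↔ PosIn (Int.fract (t - c)) (Int.fract (s - c)) l := by
  rw [coe_mem_circleArc]
  have ht := Int.floor_add_fract (t - c)
  have hs := Int.floor_add_fract (s - c)
  have ht0 := Int.fract_nonneg (t - c)
  have hs0 := Int.fract_nonneg (s - c)
  have ht1 := Int.fract_lt_one (t - c)
  have hs1 := Int.fract_lt_one (s - c)
  generalize Int.fract (t - c) = p at *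
  generalize Int.fract (s - c) = q at *
  generalize ⌊t - c⌋ = i at *
  generalize ⌊s - c⌋ = j at *
  constructor
  · rintro ⟨k, h1, h2⟩
    have e1 : (-1 : ℝ) < ((k + i - j : ℤ) : ℝ) := by push_cast; linarith
    have e2 : ((k + i - j : ℤ) : ℝ) < 2 := by push_cast; linarith
    have e1' : (-1 : ℤ) < k + i - j := by exact_mod_cast e1
    have e2' : k + i - j < 2 := by exact_mod_cast e2
    obtain h | h : k + i - j = 0 ∨ k + i - j = 1 := by omega
    · have h' : (k : ℝ) + i - j = 0 := by exact_mod_cast h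
      left; constructor <;> linarith
    · have h' : (k : ℝ) + i - j = 1 := by exact_mod_cast h
      right; constructor <;> linarith
  · rintro (⟨h1, h2⟩ | ⟨h1, h2⟩)
    · exact ⟨j - i, by push_cast; linarith, by push_cast; linarith⟩
    · exact ⟨j - i + 1, by push_cast; linarith, by push_cast; linarith⟩

/-- In a family of arcs, `u` starts in `v` if the starting point of the arc of `u` lies in the arc
of `v`. The relation is taken relative to an arbitrary cut of the circle at the start of the arc of
`c`, and its values on an induced four-cycle are governed by linear inequalities. -/
lemma IsCircularArcGraph.exists_startsIn {G : SimpleGraph V} (hG : G.IsCircularArcGraph) :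
    ∃ L : V → V → Prop, (∀ u v, u ≠ v → (G.Adj u v ↔ L u v ∨ L v u)) ∧
      ∀ c, ∃ p l : V → ℝ, p c = 0 ∧ (∀ v, 0 ≤ p v ∧ p v < 1 ∧ 0 < l v ∧ l v < 1) ∧
        ∀ u v, L u v ↔ PosIn (p u) (p v) (l v) := by
  obtain ⟨s, len, hlen, hadj⟩ := hG
  refine ⟨fun u v => (s u : AddCircle (1 : ℝ)) ∈ circleArc (s v) (len v), fun u v huv => ?_,
    fun c => ⟨fun v => Int.fract (s v - s c), len, by simp, fun v =>
      ⟨Int.fract_nonneg _, Int.fract_lt_one _, hlen v⟩,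
      fun u v => coe_mem_circleArc_iff_posIn _ _ _ (hlen v).2⟩⟩
  rw [hadj u v huv, circleArc_inter_nonempty (hlen u).1.le (hlen v).1.le]

/-- The four arcs of an induced four-cycle `a a' b b'` go round the circle, and `L a b'` says that
they do so in this order. The order can be read off from `a` or from `b`, and it is
reversed when the two disjoint pairs are exchanged. -/
lemma IsCircularArcGraph.exists_rotation {G : SimpleGraph V} (hG : G.IsCircularArcGraph) :
    ∃ L : V → V → Prop, ∀ a b a' b', G.InducesC4 a b a' b' →
      (L a b' ↔ L b a') ∧ (L a b' ↔ ¬ L a' b) := by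
  obtain ⟨L, hL, hpos⟩ := hG.exists_startsIn
  have nadj : ∀ {u v}, u ≠ v → ¬ G.Adj u v → ¬ L u v ∧ ¬ L v u := fun h h' => by
    rwa [hL _ _ h, not_or] at h'
  have adj : ∀ {u v}, G.Adj u v → L u v ∨ L v u := fun h => (hL _ _ h.ne).1 h
  -- the arc of `a` starts in one of its two neighbours
  have h1 : ∀ a b a' b', G.InducesC4 a b a' b' → L a a' ∨ L a b' := by
    intro a b a' b' h
    have g1 := nadj h.ne h.not_adj
    have g2 := nadj h.ne' h.not_adj'
    have g3 := adj h.aa'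
    have g4 := adj h.ab'
    have g5 := adj h.ba'
    have g6 := adj h.bb'
    obtain ⟨p, l, h0, hp, hLp⟩ := hpos a
    have ha := hp a
    have hb := hp b
    have ha' := hp a'
    have hb' := hp b'
    simp only [hLp, h0, PosIn] at g1 g2 g3 g4 g5 g6 ⊢
    clear hp hLp hpos hL nadj adj h
    grind
  -- no arc contains the starting points of both of its neighbours
  have h2 : ∀ a b a' b', G.InducesC4 a b a' b' → L a b' → ¬ L b b' := by
    intro a b a' b' h e1 e2
    have g1 := nadj h.ne h.not_adj
    have g2 := nadj h.ne' h.not_adj'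
    have g3 := adj h.aa'
    have g5 := adj h.ba'
    obtain ⟨p, l, h0, hp, hLp⟩ := hpos b'
    have ha := hp a
    have hb := hp b
    have ha' := hp a'
    have hb' := hp b'
    simp only [hLp, h0, PosIn] at g1 g2 g3 g5 e1 e2
    clear hp hLp hpos hL nadj adj h h1
    grind
  -- if the arcs of `a` and `b'` contain each other's starting points, then those of `b` and `a'`
  -- do not
  have h3 : ∀ a b a' b', G.InducesC4 a b a' b' → L a b' → L b' a → L b a' → ¬ L a' b := by
    intro a b a' b' h e1 e2 e3 e4
    have g1 := nadj h.ne h.not_adj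
    have g2 := nadj h.ne' h.not_adj'
    have g3 := adj h.aa'
    have g6 := adj h.bb'
    obtain ⟨p, l, h0, hp, hLp⟩ := hpos a
    have ha := hp a
    have hb := hp b
    have ha' := hp a'
    have hb' := hp b'
    simp only [hLp, h0, PosIn] at g1 g2 g3 g6 e1 e2 e3 e4
    clear hp hLp hpos hL nadj adj h h1 h2
    grind
  have h4 : ∀ a b a' b', G.InducesC4 a b a' b' → L a b' → L b a' := fun a b a' b' h e =>
    (h1 _ _ _ _ h.flip_left).resolve_right (h2 _ _ _ _ h e)
  refine ⟨L, fun a b a' b' h => ⟨⟨h4 _ _ _ _ h, h4 _ _ _ _ h.flip_left.flip_right⟩,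
    fun e e' => h3 _ _ _ _ h e (h4 _ _ _ _ h.symm e') (h4 _ _ _ _ h e) e',
    fun e => ?_⟩⟩
  by_contra e'
  have f1 := (h1 _ _ _ _ h).resolve_right e'
  have f2 := (h1 _ _ _ _ h.symm).resolve_right e
  exact h3 _ _ _ _ h.flip_right f1 f2 (h4 _ _ _ _ h.flip_right f1)
    (h4 _ _ _ _ h.symm.flip_right f2)

end SimpleGraph

namespace SimpleGraph

variable {V : Type*}

/-! ### Maximal independent sets of the auxiliary graph -/

/-- A maximal independent set of the auxiliary graph of the complement of `G`, as a symmetric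
relation on the vertices. -/
structure IsMaxIndepRel (G : SimpleGraph V) (m : V → V → Prop) : Prop where
  symm : ∀ {u v}, m u v → m v u
  ne : ∀ {u v}, m u v → u ≠ v
  not_adj : ∀ {u v}, m u v → ¬ G.Adj u v
  indep : ∀ {a b a' b'}, m a b → m a' b' → ¬ G.InducesC4 a b a' b'
  maximal : ∀ {u v}, u ≠ v → ¬ G.Adj u v → ¬ m u v → ∃ a b, m a b ∧ G.InducesC4 u v a b

section Chain

lemma _root_.Bool.eq_of_ne_of_ne {x y z : Bool} (h : x ≠ z) (h' : y ≠ z) : x = y := by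
  revert x y z
  decide

variable {G : SimpleGraph V} {c : V → Bool}

lemma IsCoBipartite.exists_side (hG : G.IsCoBipartite) :
    ∃ c : V → Bool, ∀ u v, u ≠ v → c u = c v → G.Adj u v := by
  obtain ⟨f⟩ := hG
  refine ⟨fun v => decide (f v = 0), fun u v huv h => ?_⟩
  by_contra hn
  have h1 := f.valid ((compl_adj G u v).2 ⟨huv, hn⟩)
  have h2 : (f u = 0) ↔ (f v = 0) := by simpa using h
  omega

/-- The complement of a co-bipartite circular-arc graph has no induced six-cycle: otherwise the
rotations of the three pairs of opposite edges would be pairwise opposite. -/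
lemma not_inducesC6 (hc : ∀ u v, u ≠ v → c u = c v → G.Adj u v) {L : V → V → Prop}
    (hL : ∀ a b a' b', G.InducesC4 a b a' b' → (L a b' ↔ ¬ L a' b))
    {a₁ a₂ a₃ b₁ b₂ b₃ : V} (h12 : c a₁ = c a₂) (h23 : c a₂ = c a₃) (k12 : c b₁ = c b₂)
    (k23 : c b₂ = c b₃) (hne : c a₁ ≠ c b₁) (h1 : G.Adj a₁ b₁) (h2 : G.Adj a₂ b₂)
    (h3 : G.Adj a₃ b₃) (n12 : ¬ G.Adj a₁ b₂) (n13 : ¬ G.Adj a₁ b₃) (n21 : ¬ G.Adj a₂ b₁)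
    (n23 : ¬ G.Adj a₂ b₃) (n31 : ¬ G.Adj a₃ b₁) (n32 : ¬ G.Adj a₃ b₂) : False := by
  have key : ∀ {a b a' b'}, c a = c a' → c b = c b' → c a ≠ c b → G.Adj a b → G.Adj a' b' →
      ¬ G.Adj a b' → ¬ G.Adj a' b → (L a b ↔ ¬ L a' b') := by
    intro a b a' b' e1 e2 e3 e4 e5 e6 e7
    refine hL a b' a' b ⟨?_, e6, ?_, e7, hc _ _ ?_ e1, e4, e5.symm, hc _ _ ?_ e2.symm⟩
    · rintro rfl; exact e3 e2.symm
    · rintro rfl; exact e3 e1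
    · rintro rfl; exact e7 e4
    · rintro rfl; exact e6 e4
  have f1 := key h12 k12 hne h1 h2 n12 n21
  have f2 := key h23 k23 (by rwa [← h12, ← k12]) h2 h3 n23 n32
  have f3 := key (h12.trans h23) (k12.trans k23) hne h1 h3 n13 n31
  tauto

/-- A maximal independent set of the auxiliary graph is the edge set of a chain graph: the
neighbourhoods of the vertices of one side are nested. -/
lemma IsMaxIndepRel.chain (hc : ∀ u v, u ≠ v → c u = c v → G.Adj u v) {L : V → V → Prop}
    (hL : ∀ a b a' b', G.InducesC4 a b a' b' → (L a b' ↔ ¬ L a' b)) {m : V → V → Prop}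
    (hm : G.IsMaxIndepRel m) {a b a' b' : V} (hab : m a b) (hab' : m a' b') (haa : c a = c a') :
    m a b' ∨ m a' b := by
  have side : ∀ {u v}, u ≠ v → ¬ G.Adj u v → c u ≠ c v := fun h1 h2 h3 => h2 (hc _ _ h1 h3)
  have C6 := @not_inducesC6 V G c hc L hL
  -- an edge missing from the set is in conflict with an edge of the set, which can be oriented
  have ext : ∀ {u v}, c u ≠ c v → ¬ G.Adj u v → ¬ m u v → ∃ x y, m x y ∧ c x = c u ∧ c y = c v ∧
      G.Adj u y ∧ G.Adj x v := by
    intro u v h1 h2 h3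
    have huv : u ≠ v := by rintro rfl; exact h1 rfl
    obtain ⟨x, y, hxy, hC⟩ := hm.maximal huv h2 h3
    have := side hC.ne' hC.not_adj'
    by_cases hx : c x = c u
    · exact ⟨x, y, hxy, hx, Bool.eq_of_ne_of_ne (hx ▸ this.symm) h1.symm, hC.ab', hC.ba'.symm⟩
    · exact ⟨y, x, hm.symm hxy, Bool.eq_of_ne_of_ne this.symm (Ne.symm hx),
        Bool.eq_of_ne_of_ne hx h1.symm, hC.aa', hC.bb'.symm⟩
  -- two edges of the set are not in conflict
  have ind : ∀ {u v x y}, m u v → m x y → c u = c x → G.Adj u y → ¬ G.Adj x v := by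
    intro u v x y h1 h2 h3 h4 h5
    have s1 := side (hm.ne h1) (hm.not_adj h1)
    have s2 := side (hm.ne h2) (hm.not_adj h2)
    refine hm.indep h1 h2 ⟨hm.ne h1, hm.not_adj h1, hm.ne h2, hm.not_adj h2, hc _ _ ?_ h3, h4,
      h5.symm, hc _ _ ?_ (Bool.eq_of_ne_of_ne s1.symm (h3 ▸ s2.symm))⟩
    · rintro rfl; exact hm.not_adj h1 h5
    · rintro rfl; exact hm.not_adj h1 h4
  -- edges in conflict with the missing edges `ab'` and `a'b` complete an induced six-cycle
  have main : ∀ {a b a' b'}, m a b → m a' b' → c a = c a' → ¬ G.Adj a b' → ¬ m a b' →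
      ¬ m a' b → False := by
    intro a b a' b' hab hab' haa h1 h2 h3
    have s1 := side (hm.ne hab) (hm.not_adj hab)
    have s2 := side (hm.ne hab') (hm.not_adj hab')
    have n1 := hm.not_adj hab
    have n2 := hm.not_adj hab'
    have hbb : c b' = c b := Bool.eq_of_ne_of_ne (haa ▸ s2.symm) s1.symm
    obtain ⟨a₁, b₁, m1, ca1, cb1, e1, e2⟩ := ext (hbb ▸ s1) h1 h2
    have n3 := hm.not_adj m1
    have n4 : ¬ G.Adj a₁ b := ind hab m1 ca1.symm e1
    have n5 : ¬ G.Adj a' b₁ := ind m1 hab' (ca1.trans haa) e2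
    have hne : c a₁ ≠ c b' := by rw [ca1, hbb]; exact s1
    by_cases hab2 : G.Adj a' b
    · exact C6 ca1 haa cb1.symm (cb1.trans hbb) hne e2 e1 hab2 n3 n4 h1 n1 n2 n5
    · obtain ⟨a₂, b₂, m2, ca2, cb2, e3, e4⟩ := ext (hbb ▸ s2) hab2 h3
      have n6 := hm.not_adj m2
      have n7 : ¬ G.Adj a b₂ := ind m2 hab (ca2.trans haa.symm) e4
      have n8 : ¬ G.Adj a₂ b' := ind hab' m2 ca2.symm e3
      by_cases e5 : G.Adj a₂ b₁
      · have n9 : ¬ G.Adj a₁ b₂ := ind m2 m1 (ca2.trans (haa.symm.trans ca1.symm)) e5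
        exact C6 (ca1.trans haa) ca2.symm (hbb.trans cb2.symm)
          (cb2.trans (hbb.symm.trans cb1.symm)) hne e2 e3 e5 n9 n3 n2 n5 n8 n6
      · exact C6 (ca1.trans (haa.trans ca2.symm)) (ca2.trans haa.symm) hbb
          (hbb.symm.trans cb1.symm) hne e2 e4 e1 n4 n3 n8 e5 h1 n1
  by_contra hcon
  rw [not_or] at hcon
  by_cases h1 : G.Adj a b'
  · exact main hab' hab haa.symm (ind hab hab' haa h1) hcon.2 hcon.1
  · exact main hab hab' haa h1 hcon.1 hcon.2

end Chain

/-! ### Interval models of complements of chain graphs -/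

section IntervalModel

open Classical in
/-- The left end point of `v` in the interval model of the complement of the chain graph `m`, where
`A` is a side of `m`. -/
noncomputable def chainLeft (m : V → V → Prop) (A : V → Prop) (v : V) : ℕ :=
  if A v then 0 else {x | m x v}.ncard + 1

open Classical in
/-- The right end point of `v` in the interval model of the complement of the chain graph `m`, where
`A` is a side of `m`. -/
noncomputable def chainRight (m : V → V → Prop) (A : V → Prop) (v : V) : ℕ :=
  if A v then {x | A x ∧ ∃ w, m x w ∧ ¬ m v w}.ncard + 1 else Nat.card V + 2

variable {m : V → V → Prop} {A : V → Prop}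

lemma chainLeft_lt_chainRight [Finite V] (v : V) : chainLeft m A v < chainRight m A v := by
  unfold chainLeft chainRight
  split_ifs
  · omega
  · have := Set.ncard_le_card {x | m x v}
    omega

/-- The number of neighbours of `w` exceeds the number of vertices whose neighbourhood is strictly
larger than that of `v` exactly if `v` is one of these neighbours. -/
lemma chainRight_lt_chainLeft_iff [Finite V] (hside : ∀ {u v}, m u v → (A u ↔ ¬ A v))
    (hchain : ∀ {a b a' b'}, A a → A a' → m a b → m a' b' → m a b' ∨ m a' b) {v w : V} (hv : A v)
    (hw : ¬ A w) : chainRight m A v < chainLeft m A w ↔ m v w := by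
  simp only [chainLeft, chainRight, hv, hw, if_true, if_false, add_lt_add_iff_right]
  constructor
  · intro h
    by_contra hvw
    refine absurd (Set.ncard_le_ncard (s := {x | m x w}) ?_) (not_le.2 h)
    intro x hx
    exact ⟨(hside hx).2 hw, w, hx, hvw⟩
  · intro hvw
    refine Set.ncard_lt_ncard (Set.ssubset_iff_of_subset ?_ |>.2 ⟨v, hvw, ?_⟩)
    · rintro x ⟨hx, y, hxy, hvy⟩
      exact (hchain hv hx hvw hxy).resolve_left hvy
    · rintro ⟨_, y, h1, h2⟩
      exact h2 h1

/-- Two closed intervals meet if and only if neither lies to the left of the other. -/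
lemma Icc_inter_Icc_nonempty {a b c d : ℝ} (h : a ≤ b) (h' : c ≤ d) :
    (Set.Icc a b ∩ Set.Icc c d).Nonempty ↔ a ≤ d ∧ c ≤ b := by
  rw [Set.Icc_inter_Icc, Set.nonempty_Icc, sup_le_iff, le_inf_iff, le_inf_iff]
  tauto

lemma intervalModelGraph_chain_adj [Finite V] (hsymm : ∀ {u v}, m u v → m v u)
    (hside : ∀ {u v}, m u v → (A u ↔ ¬ A v))
    (hchain : ∀ {a b a' b'}, A a → A a' → m a b → m a' b' → m a b' ∨ m a' b) (u v : V) :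
    (intervalModelGraph (fun v => (chainLeft m A v : ℝ)) (fun v => (chainRight m A v : ℝ))).Adj u v
      ↔ u ≠ v ∧ ¬ m u v := by
  have hlt : ∀ v, (chainLeft m A v : ℝ) ≤ chainRight m A v := fun v => by
    exact_mod_cast (chainLeft_lt_chainRight v).le
  have hmeet := Icc_inter_Icc_nonempty (hlt u) (hlt v)
  norm_cast at hmeet
  simp only [intervalModelGraph, hmeet]
  refine and_congr_right fun _ => ?_
  have key : ∀ {v w}, A v → ¬ A w →
      (chainLeft m A v ≤ chainRight m A w ∧ chainLeft m A w ≤ chainRight m A v ↔ ¬ m v w) := by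
    intro v w hv hw
    have h := chainRight_lt_chainLeft_iff (m := m) (A := A) hside hchain hv hw
    rw [← h, not_lt]
    exact and_iff_right (by simp [chainLeft, hv])
  by_cases hu : A u <;> by_cases hv : A v
  · simp only [show ¬ m u v from fun h => (hside h).1 hu hv, not_false_iff, iff_true]
    simp [chainLeft, hu, hv]
  · exact key hu hv
  · rw [and_comm, key hv hu]
    exact not_congr ⟨hsymm, hsymm⟩
  · simp only [show ¬ m u v from fun h => hu ((hside h).2 hv), not_false_iff, iff_true]
    have h1 := Set.ncard_le_card {x | m x u}
    have h2 := Set.ncard_le_card {x | m x v}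
    simp only [chainLeft, chainRight, hu, hv, if_false]
    omega

end IntervalModel

/-! ### Boxicity and the chromatic number of the auxiliary graph -/

section Boxicity

variable {G : SimpleGraph V}

lemma adj_of_not_compl {u v : V} : (u ≠ v ∧ ¬ Gᶜ.Adj u v) ↔ G.Adj u v := by
  rw [compl_adj]
  constructor
  · rintro ⟨h, h'⟩
    by_contra hn
    exact h' ⟨h, hn⟩
  · exact fun h => ⟨h.ne, fun h' => h'.2 h⟩

/-- Adjacency in the auxiliary graph of the complement of `G` means an induced four-cycle of `G`. -/
lemma auxGraph_compl_adj {a b a' b' : V} (h : s(a, b) ∈ Gᶜ.edgeSet) (h' : s(a', b') ∈ Gᶜ.edgeSet) :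
    Gᶜ.auxGraph.Adj ⟨s(a, b), h⟩ ⟨s(a', b'), h'⟩ ↔ G.InducesC4 a b a' b' := by
  simp only [auxGraph, adj_of_not_compl, Sym2.mem_iff, forall_eq_or_imp, forall_eq]
  rw [mem_edgeSet, compl_adj] at h h'
  exact ⟨fun e => ⟨h.1, h.2, h'.1, h'.2, e.1.1, e.1.2, e.2.1, e.2.2⟩,
    fun e => ⟨⟨e.aa', e.ab'⟩, e.ba', e.bb'⟩⟩

lemma IsIntervalGraph.not_inducesC4 {I : SimpleGraph V} (hI : I.IsIntervalGraph) {a b a' b' : V} :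
    ¬ I.InducesC4 a b a' b' := by
  intro h
  obtain ⟨l, r, hlr, rfl⟩ := hI
  have adj : ∀ u v, u ≠ v → ((intervalModelGraph l r).Adj u v ↔ l u ≤ r v ∧ l v ≤ r u) :=
    fun u v huv => by
      simp only [intervalModelGraph, Icc_inter_Icc_nonempty (hlr u).le (hlr v).le]
      exact and_iff_right huv
  have h1 := (adj _ _ h.ne).not.1 h.not_adj
  have h2 := (adj _ _ h.ne').not.1 h.not_adj'
  have h3 := (adj _ _ h.aa'.ne).1 h.aa'
  have h4 := (adj _ _ h.ab'.ne).1 h.ab'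
  have h5 := (adj _ _ h.ba'.ne).1 h.ba'
  have h6 := (adj _ _ h.bb'.ne).1 h.bb'
  have := hlr a
  have := hlr b
  have := hlr a'
  have := hlr b'
  clear h adj
  grind

/-- The edges of the complement of `G` that are missing from one interval supergraph form an
independent set of the auxiliary graph. -/
lemma IsBoxRepresentation.colorable {k : ℕ} {I : Fin k → SimpleGraph V}
    (hI : G.IsBoxRepresentation I) : Gᶜ.auxGraph.Colorable k := by
  have hle : ∀ i, G ≤ I i := fun i => hI.2 ▸ iInf_le I i
  have hex : ∀ e : Gᶜ.edgeSet, ∃ i, ∀ a b, (e : Sym2 V) = s(a, b) → ¬ (I i).Adj a b := by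
    rintro ⟨e, he⟩
    induction e with
    | _ a b =>
      rw [mem_edgeSet, compl_adj, ← hI.2, iInf_adj] at he
      obtain ⟨hne, hna⟩ := he
      rw [not_and_or, or_iff_left (not_not.2 hne), not_forall] at hna
      obtain ⟨i, hi⟩ := hna
      refine ⟨i, fun a' b' hab => ?_⟩
      rcases Sym2.eq_iff.1 hab with ⟨rfl, rfl⟩ | ⟨rfl, rfl⟩
      · exact hi
      · exact fun h => hi h.symm
  choose f hf using hex
  refine ⟨Coloring.mk f ?_⟩
  rintro ⟨e, he⟩ ⟨e', he'⟩ hadj heq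
  induction e with
  | _ a b =>
    induction e' with
    | _ a' b' =>
      have h := (auxGraph_compl_adj he he').1 hadj
      refine (hI.1 (f ⟨s(a, b), he⟩)).not_inducesC4 (a := a) (b := b) (a' := a') (b' := b')
        ⟨h.ne, hf _ _ _ rfl, h.ne', ?_, hle _ h.aa', hle _ h.ab', hle _ h.ba', hle _ h.bb'⟩
      rw [heq]
      exact hf _ _ _ rfl

lemma chromaticNumber_le_boxicity : Gᶜ.auxGraph.chromaticNumber ≤ G.boxicity :=
  le_iInf₂ fun _ ⟨_, hI⟩ => hI.colorable.chromaticNumber_le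

/-- Maximal independent sets of the auxiliary graph that cover its vertices give a box
representation. -/
lemma isBoxRepresentation_of_isMaxIndepRel [Finite V] (hco : G.IsCoBipartite)
    (hca : G.IsCircularArcGraph) {k : ℕ} {I : Fin k → SimpleGraph V} {m : Fin k → V → V → Prop}
    (hm : ∀ i, G.IsMaxIndepRel (m i)) (hI : ∀ i u v, (I i).Adj u v ↔ u ≠ v ∧ ¬ m i u v)
    (hcover : ∀ u v, u ≠ v → ¬ G.Adj u v → ∃ i, m i u v) : G.IsBoxRepresentation I := by
  obtain ⟨c, hc⟩ := hco.exists_side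
  obtain ⟨L, hL⟩ := hca.exists_rotation
  have hL' := fun a b a' b' h => (hL a b a' b' h).2
  refine ⟨fun i => ⟨fun v => chainLeft (m i) (fun v => c v = true) v,
    fun v => chainRight (m i) (fun v => c v = true) v, fun v => ?_, ?_⟩, ?_⟩
  · exact Nat.cast_lt.2 (chainLeft_lt_chainRight v)
  · ext u v
    rw [hI, intervalModelGraph_chain_adj (hm i).symm]
    · intro u v h
      have h1 : c u ≠ c v := fun e => (hm i).not_adj h (hc _ _ ((hm i).ne h) e)
      revert h1
      cases c u <;> cases c v <;> decide
    · exact fun ha ha' h h' => (hm i).chain hc hL' h h' (ha.trans ha'.symm)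
  · ext u v
    rw [iInf_adj]
    simp only [hI]
    constructor
    · rintro ⟨h, hne⟩
      by_contra hn
      obtain ⟨i, hi⟩ := hcover u v hne hn
      exact (h i).2 hi
    · exact fun h => ⟨fun i => ⟨h.ne, fun hi => (hm i).not_adj hi h⟩, h.ne⟩

/-- Membership of the pair `uv` in a set of edges of the complement of `G`. -/
def edgeRel (M : Set Gᶜ.edgeSet) (u v : V) : Prop :=
  ∃ h : s(u, v) ∈ Gᶜ.edgeSet, (⟨s(u, v), h⟩ : Gᶜ.edgeSet) ∈ M

lemma isMaxIndepRel_edgeRel {M : Set Gᶜ.edgeSet}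
    (hM : Maximal (fun S => Gᶜ.auxGraph.IsIndepSet S) M) : G.IsMaxIndepRel (edgeRel M) where
  symm := by
    rintro u v ⟨h, hM⟩
    have e : s(u, v) = s(v, u) := Sym2.eq_swap
    exact ⟨e ▸ h, by simpa only [e] using hM⟩
  ne := fun ⟨h, _⟩ => ((compl_adj G _ _).1 h).1
  not_adj := fun ⟨h, _⟩ => ((compl_adj G _ _).1 h).2
  indep := by
    rintro a b a' b' ⟨h, hm⟩ ⟨h', hm'⟩ hC
    have hadj := (auxGraph_compl_adj h h').2 hC
    exact hM.prop hm hm' hadj.ne hadj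
  maximal := by
    intro u v hne hna huv
    have h : s(u, v) ∈ Gᶜ.edgeSet := (compl_adj G u v).2 ⟨hne, hna⟩
    by_contra hcon
    push Not at hcon
    refine huv ⟨h, hM.le_of_ge (y := insert ⟨s(u, v), h⟩ M) ?_ (Set.subset_insert _ _)
      (Set.mem_insert _ _)⟩
    have hcon' : ∀ e ∈ M, ¬ Gᶜ.auxGraph.Adj ⟨s(u, v), h⟩ e := by
      rintro ⟨e, he⟩ heM hadj
      induction e with
      | _ a b => exact hcon a b ⟨he, heM⟩ ((auxGraph_compl_adj h he).1 hadj)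
    intro e he f hf hef hadj
    rcases he with rfl | he <;> rcases hf with rfl | hf
    · exact hef rfl
    · exact hcon' _ hf hadj
    · exact hcon' _ he hadj.symm
    · exact hM.prop he hf hef hadj

lemma complOfEdges_adj {M : Set Gᶜ.edgeSet} {u v : V} :
    (Gᶜ.complOfEdges M).Adj u v ↔ u ≠ v ∧ ¬ edgeRel M u v := by
  simp only [complOfEdges, compl_adj, fromEdgeSet_adj, Set.mem_image, edgeRel]
  refine and_congr_right fun hne => not_congr ⟨?_, ?_⟩
  · rintro ⟨⟨⟨e, he⟩, heM, rfl⟩, _⟩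
    exact ⟨he, heM⟩
  · rintro ⟨h, hM⟩
    exact ⟨⟨_, hM, rfl⟩, hne⟩

lemma isBoxRepresentation_complOfEdges [Finite V] (hco : G.IsCoBipartite)
    (hca : G.IsCircularArcGraph) {k : ℕ} (c : Gᶜ.auxGraph.Coloring (Fin k))
    (M : Fin k → Set Gᶜ.edgeSet) (hM : ∀ i, Maximal (fun S => Gᶜ.auxGraph.IsIndepSet S) (M i) ∧
      c.colorClass i ⊆ M i) : G.IsBoxRepresentation (fun i => Gᶜ.complOfEdges (M i)) :=
  isBoxRepresentation_of_isMaxIndepRel hco hca (fun i => isMaxIndepRel_edgeRel (hM i).1)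
    (fun _ _ _ => complOfEdges_adj) fun u v hne hna =>
      have h : s(u, v) ∈ Gᶜ.edgeSet := (compl_adj G u v).2 ⟨hne, hna⟩
      ⟨c ⟨s(u, v), h⟩, h, (hM _).2 rfl⟩

theorem boxicity_eq_chromaticNumber [Finite V] (hco : G.IsCoBipartite)
    (hca : G.IsCircularArcGraph) : G.boxicity = Gᶜ.auxGraph.chromaticNumber := by
  refine le_antisymm ?_ chromaticNumber_le_boxicity
  refine le_iInf fun k => le_iInf fun hk => ?_
  obtain ⟨c⟩ := hk
  have hex : ∀ i, ∃ M, c.colorClass i ⊆ M ∧ Maximal (fun S => Gᶜ.auxGraph.IsIndepSet S) M :=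
    fun i => (Set.toFinite _).exists_le_maximal
      (s := {S | Gᶜ.auxGraph.IsIndepSet S}) (c.isIndepSet_colorClass i)
  choose M hM1 hM2 using hex
  exact iInf₂_le k ⟨_, isBoxRepresentation_complOfEdges hco hca c M fun i => ⟨hM2 i, hM1 i⟩⟩

theorem le_complOfEdges_and_isOptimalBoxRepresentation [Finite V] (hco : G.IsCoBipartite)
    (hca : G.IsCircularArcGraph) {k : ℕ} (hk : (k : ℕ∞) = Gᶜ.auxGraph.chromaticNumber)
    (c : Gᶜ.auxGraph.Coloring (Fin k)) (M : Fin k → Set Gᶜ.edgeSet)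
    (hM : ∀ i, Maximal (fun S => Gᶜ.auxGraph.IsIndepSet S) (M i) ∧ c.colorClass i ⊆ M i) :
    (∀ i, G ≤ Gᶜ.complOfEdges (M i)) ∧
      G.IsOptimalBoxRepresentation (fun i => Gᶜ.complOfEdges (M i)) := by
  have h := isBoxRepresentation_complOfEdges hco hca c M hM
  refine ⟨fun i => ?_, h, hk.trans (boxicity_eq_chromaticNumber hco hca).symm⟩
  calc G = ⨅ i, Gᶜ.complOfEdges (M i) := h.2.symm
    _ ≤ _ := iInf_le _ i

end Boxicity

end SimpleGraph

/-! ### Transitive orientations of comparability graphs -/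

namespace Comparability

/-- The forcing relation on the ordered pairs of adjacent vertices of a graph `K`: two pairs with a
common first or a common second component, whose other components are not adjacent, have to be
oriented alike in a transitive orientation. -/
def Force (K : ℕ → ℕ → Prop) (p q : ℕ × ℕ) : Prop :=
  K p.1 p.2 ∧ K q.1 q.2 ∧ (p.1 = q.1 ∧ ¬ K p.2 q.2 ∨ p.2 = q.2 ∧ ¬ K p.1 q.1)

/-- The pairs `p` and `q` lie in the same implication class. -/
def SameClass (K : ℕ → ℕ → Prop) : ℕ × ℕ → ℕ × ℕ → Prop := Relation.ReflTransGen (Force K)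

/-- The number of a pair of numbers below `N` in the lexicographic order. -/
def code (N : ℕ) (p : ℕ × ℕ) : ℕ := N * p.1 + p.2

/-- The lexicographic orientation: the pair `ef` is chosen if its implication class contains a pair
that lexicographically precedes every pair of the opposite class. -/
def Pos (N : ℕ) (K : ℕ → ℕ → Prop) (e f : ℕ) : Prop :=
  K e f ∧ ∃ q, SameClass K (e, f) q ∧ ∀ q', SameClass K (f, e) q' → code N q < code N q'

lemma mul_add_inj {N a b a' b' : ℕ} (hb : b < N) (hb' : b' < N) :
    N * a + b = N * a' + b' ↔ a = a' ∧ b = b' := by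
  constructor
  · intro h
    have ha : a = a' := by
      have h1 := congrArg (· / N) h
      have hN : 0 < N := by omega
      simpa [Nat.mul_add_div hN, Nat.div_eq_of_lt hb, Nat.div_eq_of_lt hb'] using h1
    subst ha
    exact ⟨rfl, by omega⟩
  · rintro ⟨rfl, rfl⟩
    rfl

variable {N : ℕ} {K : ℕ → ℕ → Prop}

lemma Force.symm (hsymm : ∀ {e f}, K e f → K f e) {p q : ℕ × ℕ} (h : Force K p q) : Force K q p :=
  ⟨h.2.1, h.1, h.2.2.imp (fun h => ⟨h.1.symm, fun h' => h.2 (hsymm h')⟩)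
    (fun h => ⟨h.1.symm, fun h' => h.2 (hsymm h')⟩)⟩

lemma Force.swap (hsymm : ∀ {e f}, K e f → K f e) {p q : ℕ × ℕ} (h : Force K p q) :
    Force K p.swap q.swap :=
  ⟨hsymm h.1, hsymm h.2.1, h.2.2.symm⟩

lemma SameClass.symm (hsymm : ∀ {e f}, K e f → K f e) {p q : ℕ × ℕ} (h : SameClass K p q) :
    SameClass K q p :=
  haveI : Std.Symm (Force K) := ⟨fun _ _ => Force.symm hsymm⟩
  Relation.ReflTransGen.stdSymm.symm _ _ h

lemma SameClass.swap (hsymm : ∀ {e f}, K e f → K f e) {p q : ℕ × ℕ} (h : SameClass K p q) :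
    SameClass K p.swap q.swap := by
  induction h with
  | refl => exact .refl
  | tail _ h ih => exact ih.tail (h.swap hsymm)

lemma SameClass.adj {p q : ℕ × ℕ} (h : SameClass K p q) (hp : K p.1 p.2) : K q.1 q.2 := by
  induction h with
  | refl => exact hp
  | tail _ h _ => exact h.2.1

lemma Pos.asymm {e f : ℕ} (h : Pos N K e f) : ¬ Pos N K f e := by
  rintro ⟨_, q, hq, hq'⟩
  obtain ⟨_, r, hr, hr'⟩ := h
  exact absurd (hr' q hq) (not_lt.2 (hq' r hr).le)

lemma Pos.of_sameClass (hsymm : ∀ {e f}, K e f → K f e) {e f e' f' : ℕ} (h : Pos N K e f)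
    (hc : SameClass K (e, f) (e', f')) : Pos N K e' f' := by
  obtain ⟨hK, q, hq, hq'⟩ := h
  exact ⟨hc.adj hK, q, (hc.symm hsymm).trans hq, fun q' h' => hq' q' ((hc.swap hsymm).trans h')⟩

/-- The graph `K` on the numbers below `N` has an orientation that the forcing relation respects; in
other words, no implication class contains a pair together with its reversal. -/
structure Orientable (N : ℕ) (K : ℕ → ℕ → Prop) : Prop where
  symm : ∀ {e f}, K e f → K f e
  lt : ∀ {e f}, K e f → e < N
  not_sameClass : ∀ {e f}, K e f → ¬ SameClass K (e, f) (f, e)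

lemma Orientable.total (hK : Orientable N K) {e f : ℕ} (h : K e f) : Pos N K e f ∨ Pos N K f e := by
  have hmin : ∀ p, ∃ q, SameClass K p q ∧ ∀ q', SameClass K p q' → code N q ≤ code N q' := by
    intro p
    obtain ⟨q, hq, hq'⟩ := (measure (code N)).wf.has_min {q | SameClass K p q} ⟨p, .refl⟩
    exact ⟨q, hq, fun q' h' => not_lt.1 (hq' q' h')⟩
  obtain ⟨q, hq, hq'⟩ := hmin (e, f)
  obtain ⟨r, hr, hr'⟩ := hmin (f, e)
  rcases lt_trichotomy (code N q) (code N r) with hlt | heq | hlt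
  · exact Or.inl ⟨h, q, hq, fun q' h' => hlt.trans_le (hr' q' h')⟩
  · refine absurd (hq.trans (?_ : SameClass K q (f, e))) (hK.not_sameClass h)
    have h1 := hK.lt (hK.symm (hq.adj h))
    have h2 := hK.lt (hK.symm (hr.adj (hK.symm h)))
    obtain ⟨h3, h4⟩ := (mul_add_inj h1 h2).1 heq
    rw [Prod.ext h3 h4]
    exact hr.symm hK.symm
  · exact Or.inr ⟨hK.symm h, r, hr, fun q' h' => hlt.trans_le (hq' q' h')⟩

/-- The triangle lemma: in a cyclically oriented triangle `u v w`, the pair `vw` can be replaced by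
any pair of its class, without a change of the other two classes. -/
lemma Orientable.triangle (hK : Orientable N K) {u v w : ℕ} (huv : Pos N K u v)
    (hvw : Pos N K v w) (hwu : Pos N K w u) {q : ℕ × ℕ} (hq : SameClass K (v, w) q) :
    SameClass K (u, v) (u, q.1) ∧ SameClass K (w, u) (q.2, u) := by
  induction hq with
  | refl => exact ⟨.refl, .refl⟩
  | @tail p q hp hpq ih =>
    obtain ⟨h1, h2⟩ := ih
    have hpos := hvw.of_sameClass hK.symm (hp.tail hpq : SameClass K (v, w) (q.1, q.2))
    have hup := huv.of_sameClass hK.symm h1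
    have hpu := hwu.of_sameClass hK.symm h2
    obtain ⟨kp, kq, ⟨e, n⟩ | ⟨e, n⟩⟩ := hpq
    · rw [← e] at hpos kq ⊢
      refine ⟨h1, h2.tail ⟨hpu.1, ?_, Or.inr ⟨rfl, n⟩⟩⟩
      by_contra hn
      have : SameClass K (p.1, q.2) (p.1, u) := .single ⟨kq, hK.symm hup.1, Or.inl ⟨rfl, hn⟩⟩
      exact (hpos.of_sameClass hK.symm this).asymm hup
    · rw [← e] at hpos kq ⊢
      refine ⟨h1.tail ⟨hup.1, ?_, Or.inl ⟨rfl, n⟩⟩, h2⟩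
      by_contra hn
      have : SameClass K (q.1, p.2) (u, p.2) :=
        .single ⟨kq, hK.symm hpu.1, Or.inr ⟨rfl, fun h => hn (hK.symm h)⟩⟩
      exact (hpos.of_sameClass hK.symm this).asymm hpu

/-- No triangle is oriented cyclically. In a cyclic triangle `u p q` with `pq` lexicographically as
small as possible, the pair that decides the orientation of `up` would have to be of
the form `pt`; by the triangle lemma, `qp` would then be in the class of `qu`. -/
lemma Orientable.not_cyclic (hK : Orientable N K) {u v w : ℕ} (huv : Pos N K u v)
    (hvw : Pos N K v w) : ¬ Pos N K w u := by
  intro hwu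
  obtain ⟨⟨u, p, q⟩, ⟨h1, h2, h3⟩, hmin⟩ := (measure fun t : ℕ × ℕ × ℕ => code N t.2).wf.has_min
    {t | Pos N K t.1 t.2.1 ∧ Pos N K t.2.1 t.2.2 ∧ Pos N K t.2.2 t.1} ⟨(u, v, w), huv, hvw, hwu⟩
  obtain ⟨hk, ⟨s, t⟩, hs, hs'⟩ := id h1
  have hlt : code N (s, t) < code N (p, u) := hs' (p, u) .refl
  obtain ⟨c1, c2⟩ := hK.triangle h3 h1 h2 hs
  have hge : code N (p, q) ≤ code N (s, t) := not_lt.1 (hmin (q, s, t)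
    ⟨h3.of_sameClass hK.symm c1, h1.of_sameClass hK.symm hs, h2.of_sameClass hK.symm c2⟩)
  have ht : t < N := hK.lt (hK.symm (hs.adj hk))
  have hu : u < N := hK.lt hk
  have hsp : s = p := by
    simp only [code] at hlt hge
    have hq : q < N := hK.lt h3.1
    rcases lt_trichotomy s p with h | h | h
    · have := Nat.mul_le_mul_left N (Nat.succ_le_of_lt h)
      rw [Nat.mul_succ] at this
      omega
    · exact h
    · have := Nat.mul_le_mul_left N (Nat.succ_le_of_lt h)
      rw [Nat.mul_succ] at this
      omega
  subst hsp
  exact (h3.of_sameClass hK.symm c1).asymm h2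

/-- The lexicographic orientation is transitive. -/
lemma Orientable.trans (hK : Orientable N K) {e f g : ℕ} (hef : Pos N K e f) (hfg : Pos N K f g) :
    Pos N K e g := by
  by_cases h : K e g
  · exact (hK.total h).resolve_right (hK.not_cyclic hef hfg)
  · have : SameClass K (e, f) (g, f) := .single ⟨hef.1, hK.symm hfg.1, Or.inr ⟨rfl, h⟩⟩
    exact absurd hfg (hef.of_sameClass hK.symm this).asymm

/-! ### Heights -/

/-- A chain of `t + 1` vertices of `X`, increasing in the lexicographic orientation, ends in `e`. -/
def ChainEnd (N : ℕ) (K : ℕ → ℕ → Prop) (X : ℕ → Prop) : ℕ → ℕ → Prop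
  | 0, e => X e
  | t + 1, e => X e ∧ ∃ f, ChainEnd N K X t f ∧ Pos N K f e

variable {X : ℕ → Prop}

lemma ChainEnd.mem {t e : ℕ} (h : ChainEnd N K X t e) : X e := by
  cases t with
  | zero => exact h
  | succ t => exact h.1

lemma ChainEnd.pred {t e : ℕ} (h : ChainEnd N K X (t + 1) e) : ChainEnd N K X t e := by
  induction t generalizing e with
  | zero => exact h.1
  | succ t ih =>
    obtain ⟨hX, f, hf, hfe⟩ := h
    exact ⟨hX, f, ih hf, hfe⟩

lemma ChainEnd.mono {t t' e : ℕ} (htt' : t ≤ t') (h : ChainEnd N K X t' e) :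
    ChainEnd N K X t e := by
  induction htt' with
  | refl => exact h
  | step _ ih => exact ih h.pred

lemma ChainEnd.exists_clique (hK : Orientable N K) {t e : ℕ} (h : ChainEnd N K X t e) :
    ∃ s : Finset ℕ, s.card = t + 1 ∧ (∀ f ∈ s, X f) ∧ (∀ f ∈ s, f = e ∨ Pos N K f e) ∧
      ∀ f ∈ s, ∀ g ∈ s, f ≠ g → K f g := by
  induction t generalizing e with
  | zero => exact ⟨{e}, by simp, by simpa [ChainEnd] using h, by simp, by simp +contextual⟩
  | succ t ih =>
    obtain ⟨hX, f, hf, hfe⟩ := h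
    obtain ⟨s, hs, hsX, hsf, hsK⟩ := ih hf
    have hlt : ∀ g ∈ s, Pos N K g e := fun g hg => by
      rcases hsf g hg with rfl | h
      · exact hfe
      · exact hK.trans h hfe
    have he : e ∉ s := fun he => (hlt e he).asymm (hlt e he)
    refine ⟨insert e s, by rw [Finset.card_insert_of_notMem he, hs], ?_, ?_, ?_⟩
    · exact Finset.forall_mem_insert _ _ _ |>.2 ⟨hX, hsX⟩
    · exact Finset.forall_mem_insert _ _ _ |>.2 ⟨Or.inl rfl, fun g hg => Or.inr (hlt g hg)⟩
    · intro g hg g' hg' hne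
      rw [Finset.mem_insert] at hg hg'
      rcases hg with rfl | hg <;> rcases hg' with rfl | hg'
      · exact absurd rfl hne
      · exact hK.symm (hlt g' hg').1
      · exact (hlt g hg).1
      · exact hsK g hg g' hg' hne

/-- A chain has at most `N` vertices. -/
lemma ChainEnd.lt (hK : Orientable N K) (hX : ∀ e, X e → e < N) {t e : ℕ}
    (h : ChainEnd N K X t e) : t < N := by
  obtain ⟨s, hs, hsX, -, -⟩ := h.exists_clique hK
  have : s ⊆ Finset.range N := fun f hf => Finset.mem_range.2 (hX f (hsX f hf))
  have := Finset.card_le_card this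
  rw [Finset.card_range] at this
  omega

/-- The vertex `e` has height `i`: the longest chain that ends in `e` has `i + 1` vertices. -/
def HasHeight (N : ℕ) (K : ℕ → ℕ → Prop) (X : ℕ → Prop) (i e : ℕ) : Prop :=
  ChainEnd N K X i e ∧ ¬ ChainEnd N K X (i + 1) e

lemma exists_hasHeight (hK : Orientable N K) (hX : ∀ e, X e → e < N) {e : ℕ} (he : X e) :
    ∃ i, HasHeight N K X i e := by
  classical
  have hex : ∃ i, ¬ ChainEnd N K X i e := ⟨N, fun h => (h.lt hK hX).false⟩
  have h0 : Nat.find hex ≠ 0 := fun h => Nat.find_spec hex (h ▸ he)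
  obtain ⟨i, hi⟩ := Nat.exists_eq_succ_of_ne_zero h0
  refine ⟨i, ?_, ?_⟩
  · exact not_not.1 (Nat.find_min hex (hi ▸ i.lt_succ_self))
  · have := Nat.find_spec hex
    rwa [hi] at this

lemma HasHeight.not_adj (hK : Orientable N K) {i e f : ℕ} (he : HasHeight N K X i e)
    (hf : HasHeight N K X i f) : ¬ K e f := by
  intro h
  rcases hK.total h with h | h
  · exact hf.2 ⟨hf.1.mem, e, he.1, h⟩
  · exact he.2 ⟨he.1.mem, f, hf.1, h⟩

/-! ### Greedy extension of independent sets -/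

/-- The greedy extension of a set `C` of vertices of `K` to a maximal independent subset
of `X`: the elements of `X` are inspected in increasing order. -/
def Greedy (K : ℕ → ℕ → Prop) (X C : ℕ → Prop) (e : ℕ) : Prop :=
  X e ∧ (∀ f, C f → ¬ K e f) ∧ ∀ f, ∀ _ : f < e, Greedy K X C f → ¬ K e f

variable {C : ℕ → Prop}

lemma greedy_iff {e : ℕ} : Greedy K X C e ↔
    X e ∧ (∀ f, C f → ¬ K e f) ∧ ∀ f, f < e → Greedy K X C f → ¬ K e f := by
  rw [Greedy]

lemma Greedy.of_mem (hsymm : ∀ {e f}, K e f → K f e) (hCX : ∀ e, C e → X e)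
    (hC : ∀ e f, C e → C f → ¬ K e f) {e : ℕ} (he : C e) : Greedy K X C e :=
  greedy_iff.2 ⟨hCX e he, fun _ hf => hC _ _ he hf,
    fun _ _ hf hef => (greedy_iff.1 hf).2.1 e he (hsymm hef)⟩

lemma Greedy.not_adj (hsymm : ∀ {e f}, K e f → K f e) (hirr : ∀ e, ¬ K e e) {e f : ℕ}
    (he : Greedy K X C e) (hf : Greedy K X C f) : ¬ K e f := by
  rcases lt_trichotomy e f with h | rfl | h
  · exact fun hef => (greedy_iff.1 hf).2.2 e h he (hsymm hef)
  · exact hirr e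
  · exact (greedy_iff.1 he).2.2 f h hf

lemma exists_adj_of_not_greedy (hsymm : ∀ {e f}, K e f → K f e) (hCX : ∀ e, C e → X e)
    (hC : ∀ e f, C e → C f → ¬ K e f) {e : ℕ} (he : X e) (hn : ¬ Greedy K X C e) :
    ∃ f, Greedy K X C f ∧ K e f := by
  by_contra hcon
  push Not at hcon
  exact hn (greedy_iff.2 ⟨he, fun f hf => hcon f (.of_mem hsymm hCX hC hf), fun f _ => hcon f⟩)

end Comparability

/-! ### Compilation of terms and table fillings to random access machine programs -/

namespace Ram

/-- The program `P`, started in `s`, halts in `s'` after at most `T` steps. -/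
def Runs (P : Prog) (s : State) (T : ℕ) (s' : State) : Prop := ∃ t ≤ T, Exec P s t s'

namespace Runs

variable {P Q : Prog} {s s' s'' : State} {T T' : ℕ}

lemma mono (h : Runs P s T s') (hT : T ≤ T') : Runs P s T' s' :=
  let ⟨t, ht, he⟩ := h; ⟨t, ht.trans hT, he⟩

lemma of_exec {t : ℕ} (h : Exec P s t s') : Runs P s t s' := ⟨t, le_rfl, h⟩

lemma seq (h : Runs P s T s') (h' : Runs Q s' T' s'') : Runs (.seq P Q) s (T + T') s'' :=
  let ⟨_, ht, he⟩ := h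
  let ⟨_, ht', he'⟩ := h'
  ⟨_, add_le_add ht ht', .seq he he'⟩

/-- The rule for loops: if the body maintains the invariant `I`, indexed by the number of rounds,
and the loop variable vanishes exactly after round `N`, then the loop halts after `N` rounds. -/
lemma loop {x B N : ℕ} (I : ℕ → State → Prop) (hpos : ∀ i s, i < N → I i s → s.reg x ≠ 0)
    (hN : ∀ s, I N s → s.reg x = 0)
    (hstep : ∀ i s, i < N → I i s → ∃ s', Runs P s B s' ∧ I (i + 1) s') {s : State} (h0 : I 0 s) :
    ∃ s', Runs (.loop x P) s (N * (B + 1) + 1) s' ∧ I N s' := by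
  suffices h : ∀ d i s, i + d = N → I i s →
      ∃ s', Runs (.loop x P) s (d * (B + 1) + 1) s' ∧ I N s' from h N 0 s (by omega) h0
  intro d
  induction d with
  | zero =>
    intro i s hi hI
    obtain rfl : i = N := by omega
    exact ⟨s, ⟨1, by omega, .loopDone (hN s hI)⟩, hI⟩
  | succ d ih =>
    intro i s hi hI
    obtain ⟨s₁, ⟨t₁, ht₁, he₁⟩, hI₁⟩ := hstep i s (by omega) hI
    obtain ⟨s₂, ⟨t₂, ht₂, he₂⟩, hI₂⟩ := ih (i + 1) s₁ (by omega) hI₁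
    refine ⟨s₂, ⟨t₁ + t₂ + 1, ?_, .loopStep (hpos i s (by omega) hI) he₁ he₂⟩, hI₂⟩
    rw [Nat.succ_mul]
    omega

end Runs

/-- Terms over the variables `0, 1, …` and the memory; `read a` is the content of the memory cell
with address `a`, and `sum x k a` is the sum of `a` over all values of the variable `x` below `n ^
k`, where `n` is the size of the input. -/
inductive Term : Type
  | lit (c : ℕ) : Term
  | var (x : ℕ) : Term
  | add (a b : Term) : Term
  | sub (a b : Term) : Term
  | ite (c a b : Term) : Term
  | read (a : Term) : Term
  | sum (x k : ℕ) (a : Term) : Term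

/-- The value of a term for input size `n`, memory `m` and variable assignment `ρ`. -/
def Term.eval (n : ℕ) (m : ℕ → ℕ) : Term → (ℕ → ℕ) → ℕ
  | .lit c, _ => c
  | .var x, ρ => ρ x
  | .add a b, ρ => a.eval n m ρ + b.eval n m ρ
  | .sub a b, ρ => a.eval n m ρ - b.eval n m ρ
  | .ite c a b, ρ => if c.eval n m ρ ≠ 0 then a.eval n m ρ else b.eval n m ρ
  | .read a, ρ => m (a.eval n m ρ)
  | .sum x k a, ρ => ∑ i ∈ Finset.range (n ^ k), a.eval n m (Function.update ρ x i)

/-- The program `P` computes `f n m ρ` into the register `2 * d + 2`, in at most `p n` steps. The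
size `n` is held by register `0` and the value of the variable `x` by the register `2 * x + 1`;
these registers and those below the target register keep their contents. -/
def Computes (P : Prog) (p : Polynomial ℕ) (d : ℕ) (f : ℕ → (ℕ → ℕ) → (ℕ → ℕ) → ℕ) : Prop :=
  ∀ (ρ : ℕ → ℕ) (s : State), (∀ x, s.reg (2 * x + 1) = ρ x) →
    ∃ s', Runs P s (p.eval (s.reg 0)) s' ∧ s'.mem = s.mem ∧
      s'.reg (2 * d + 2) = f (s.reg 0) s.mem ρ ∧
      ∀ r, r % 2 = 1 ∨ r < 2 * d + 2 → s'.reg r = s.reg r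

open Polynomial in
lemma exists_computes_pow (k d : ℕ) : ∃ P p, Computes P p d (fun n _ _ => n ^ k) := by
  induction k generalizing d with
  | zero =>
    refine ⟨.const (2 * d + 2) 1, 1, fun ρ s hρ =>
      ⟨_, ⟨1, by simp, .const _ _ _⟩, rfl, by simp, ?_⟩⟩
    intro r hr
    have : r ≠ 2 * d + 2 := by omega
    simp [this]
  | succ k ih =>
    obtain ⟨P, p, hP⟩ := ih (d + 1)
    refine ⟨.seq P (.seq (.const (2 * d + 2) 0) (.seq (.add (2 * d + 6) 0 (2 * d + 2))
      (.loop (2 * d + 6) (.seq (.add (2 * d + 2) (2 * d + 2) (2 * d + 4))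
        (.seq (.const (2 * d + 8) 1) (.sub (2 * d + 6) (2 * d + 6) (2 * d + 8))))))),
      p + (1 + (1 + (X * (3 + 1) + 1))), fun ρ s hρ => ?_⟩
    obtain ⟨s₁, hr₁, hm₁, ht₁, hp₁⟩ := hP ρ s hρ
    have h0 : s₁.reg 0 = s.reg 0 := hp₁ 0 (by omega)
    have hpres : ∀ r, r % 2 = 1 ∨ r < 2 * d + 2 → s₁.reg r = s.reg r := fun r hr => hp₁ r (by omega)
    have ht₁' : s₁.reg (2 * d + 4) = s.reg 0 ^ k := ht₁
    obtain ⟨s₂, hr₂, hm₂, h1, h2, h3, h4⟩ := Runs.loop (x := 2 * d + 6) (B := 3) (N := s.reg 0)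
      (P := .seq (.add (2 * d + 2) (2 * d + 2) (2 * d + 4))
        (.seq (.const (2 * d + 8) 1) (.sub (2 * d + 6) (2 * d + 6) (2 * d + 8))))
      (fun i s' => s'.mem = s.mem ∧ s'.reg (2 * d + 4) = s.reg 0 ^ k ∧
        s'.reg (2 * d + 2) = i * s.reg 0 ^ k ∧ s'.reg (2 * d + 6) = s.reg 0 - i ∧
        ∀ r, r % 2 = 1 ∨ r < 2 * d + 2 → s'.reg r = s.reg r)
      (fun i s' hi h => by rw [h.2.2.2.1]; omega) (fun s' h => by rw [h.2.2.2.1]; omega)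
      (fun i s' hi h => by
        refine ⟨_, (Runs.of_exec (.add _ _ _ _)).seq ((Runs.of_exec (.const _ _ _)).seq
          (Runs.of_exec (.sub _ _ _ _))), h.1, ?_, ?_, ?_, ?_⟩
        · simp [h.2.1]
        · simp [h.2.1, h.2.2.1, add_mul]
        · simp [h.2.2.2.1]
          omega
        · intro r hr
          have e1 : r ≠ 2 * d + 2 := by omega
          have e2 : r ≠ 2 * d + 6 := by omega
          have e3 : r ≠ 2 * d + 8 := by omega
          simp [e1, e2, e3, h.2.2.2.2 r hr])
      (s := ⟨Function.update (Function.update s₁.reg (2 * d + 2) 0) (2 * d + 6) (s.reg 0),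
        s₁.mem⟩) ⟨hm₁, by simp [ht₁'], by simp,
          by simp, fun r hr => by
            have e1 : r ≠ 2 * d + 2 := by omega
            have e2 : r ≠ 2 * d + 6 := by omega
            simp [e1, e2, hpres r hr]⟩
    refine ⟨s₂, ?_, hm₂, h2.trans (pow_succ' _ _).symm, h4⟩
    have ha := Exec.add (2 * d + 6) 0 (2 * d + 2)
      { s₁ with reg := Function.update s₁.reg (2 * d + 2) 0 }
    have e : (0 : ℕ) ≠ 2 * d + 2 := by omega
    simp only [Function.update_self, Function.update_of_ne e, h0, add_zero] at ha
    refine (hr₁.seq ((Runs.of_exec (.const _ _ _)).seq ((Runs.of_exec ha).seq hr₂))).mono ?_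
    simp

/-- For every body `Q` and every bound on its running time there is a program that runs `Q` for all
values of the variable `x` below `n ^ k`, in increasing order. It uses no registers except that of
`x` and those from `2 * d + 2` on; `J` is an invariant that does not depend on these. -/
lemma exists_for (x k d : ℕ) (Q : Prog) (q : Polynomial ℕ) : ∃ (P : Prog) (p : Polynomial ℕ),
    ∀ (J : ℕ → State → Prop) (s : State),
    (∀ i s s', J i s → s'.mem = s.mem →
      (∀ r, r ≠ 2 * x + 1 → r % 2 = 1 ∨ r < 2 * d + 2 → s'.reg r = s.reg r) → J i s') →
    (∀ i s', i < s.reg 0 ^ k → J i s' → s'.reg (2 * x + 1) = i →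
      ∃ s'', Runs Q s' (q.eval (s.reg 0)) s'' ∧ J (i + 1) s'' ∧ s''.reg (2 * x + 1) = i ∧
        s''.reg (2 * d + 2) = s'.reg (2 * d + 2)) →
    J 0 s → ∃ s', Runs P s (p.eval (s.reg 0)) s' ∧ J (s.reg 0 ^ k) s' := by
  obtain ⟨P, p, hP⟩ := exists_computes_pow k d
  let body : Prog := .seq Q (.seq (.const (2 * d + 4) 1)
    (.seq (.add (2 * x + 1) (2 * x + 1) (2 * d + 4)) (.sub (2 * d + 2) (2 * d + 2) (2 * d + 4))))
  refine ⟨.seq P (.seq (.const (2 * x + 1) 0) (.loop (2 * d + 2) body)),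
    p + (1 + (Polynomial.X ^ k * (q + 3 + 1) + 1)), fun J s hJ hQ h0 => ?_⟩
  obtain ⟨s₁, hr₁, hm₁, ht₁, hp₁⟩ := hP (fun x => s.reg (2 * x + 1)) s fun _ => rfl
  have c1 : 2 * x + 1 ≠ 2 * d + 2 := by omega
  have c2 : 2 * x + 1 ≠ 2 * d + 4 := by omega
  have c1' : 2 * x ≠ 2 * d + 1 := by omega
  have c2' : 2 * x ≠ 2 * d + 3 := by omega
  obtain ⟨s₂, hr₂, hJ₂, -⟩ := Runs.loop (x := 2 * d + 2) (B := q.eval (s.reg 0) + 3)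
    (N := s.reg 0 ^ k) (P := body)
    (fun i s' => J i s' ∧ s'.reg (2 * x + 1) = i ∧ s'.reg (2 * d + 2) = s.reg 0 ^ k - i)
    (fun i s' hi h => by rw [h.2.2]; omega) (fun s' h => by rw [h.2.2]; omega)
    (fun i s' hi h => by
      obtain ⟨s'', hr, hJ', hx, hd⟩ := hQ i s' hi h.1 h.2.1
      refine ⟨_, (hr.seq ((Runs.of_exec (.const _ _ _)).seq ((Runs.of_exec (.add _ _ _ _)).seq
          (Runs.of_exec (.sub _ _ _ _))))), hJ (i + 1) s'' _ hJ' rfl ?_, ?_, ?_⟩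
      · intro r hrx hr
        have e1 : r ≠ 2 * d + 2 := by omega
        have e2 : r ≠ 2 * d + 4 := by omega
        simp [e1, e2, hrx]
      · simp [c1', c2', hx]
      · simp [c1.symm, c2.symm, hd, h.2.2]
        omega)
    (s := { s₁ with reg := Function.update s₁.reg (2 * x + 1) 0 })
    ⟨hJ 0 s _ h0 hm₁ fun r hrx hr => by simp [hrx, hp₁ r hr],
      by simp, by simp [c1.symm, ht₁]⟩
  refine ⟨s₂, (hr₁.seq ((Runs.of_exec (.const _ _ _)).seq hr₂)).mono ?_, hJ₂⟩
  simp

open Polynomial in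
/-- Every term is computed by a program in polynomial time. -/
theorem Term.exists_computes (a : Term) (d : ℕ) :
    ∃ P p, Computes P p d (fun n m ρ => a.eval n m ρ) := by
  induction a generalizing d with
  | lit c =>
    refine ⟨.const (2 * d + 2) c, 1, fun ρ s hρ =>
      ⟨_, ⟨1, by simp, .const _ _ _⟩, rfl, by simp [Term.eval], fun r hr => ?_⟩⟩
    have : r ≠ 2 * d + 2 := by omega
    simp [this]
  | var x =>
    refine ⟨.seq (.const (2 * d + 2) 0) (.add (2 * d + 2) (2 * x + 1) (2 * d + 2)), 1 + 1,
      fun ρ s hρ => ⟨_, ((Runs.of_exec (.const _ _ _)).seq (Runs.of_exec (.add _ _ _ _))).mono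
        (by simp), rfl, ?_, fun r hr => ?_⟩⟩
    · have : 2 * x ≠ 2 * d + 1 := by omega
      simp [this, hρ, Term.eval]
    · have : r ≠ 2 * d + 2 := by omega
      simp [this]
  | add a b iha ihb =>
    obtain ⟨P, p, hP⟩ := iha d
    obtain ⟨Q, q, hQ⟩ := ihb (d + 1)
    refine ⟨.seq P (.seq Q (.add (2 * d + 2) (2 * d + 2) (2 * d + 4))), p + (q + 1),
      fun ρ s hρ => ?_⟩
    obtain ⟨s₁, hr₁, hm₁, ht₁, hp₁⟩ := hP ρ s hρ
    obtain ⟨s₂, hr₂, hm₂, ht₂, hp₂⟩ := hQ ρ s₁ fun x => (hp₁ _ (by omega)).trans (hρ x)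
    have h0 : s₁.reg 0 = s.reg 0 := hp₁ 0 (by omega)
    rw [h0] at hr₂ ht₂
    refine ⟨_, (hr₁.seq (hr₂.seq (Runs.of_exec (.add _ _ _ _)))).mono (by simp), hm₂.trans hm₁,
      ?_, fun r hr => ?_⟩
    · have ht₂' : s₂.reg (2 * d + 4) = _ := ht₂
      simp [ht₂', hp₂ (2 * d + 2) (by omega), ht₁, hm₁, Term.eval]
    · have : r ≠ 2 * d + 2 := by omega
      simp [this, hp₂ r (by omega), hp₁ r hr]
  | sub a b iha ihb =>
    obtain ⟨P, p, hP⟩ := iha d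
    obtain ⟨Q, q, hQ⟩ := ihb (d + 1)
    refine ⟨.seq P (.seq Q (.sub (2 * d + 2) (2 * d + 2) (2 * d + 4))), p + (q + 1),
      fun ρ s hρ => ?_⟩
    obtain ⟨s₁, hr₁, hm₁, ht₁, hp₁⟩ := hP ρ s hρ
    obtain ⟨s₂, hr₂, hm₂, ht₂, hp₂⟩ := hQ ρ s₁ fun x => (hp₁ _ (by omega)).trans (hρ x)
    have h0 : s₁.reg 0 = s.reg 0 := hp₁ 0 (by omega)
    rw [h0] at hr₂ ht₂
    refine ⟨_, (hr₁.seq (hr₂.seq (Runs.of_exec (.sub _ _ _ _)))).mono (by simp), hm₂.trans hm₁,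
      ?_, fun r hr => ?_⟩
    · have ht₂' : s₂.reg (2 * d + 4) = _ := ht₂
      simp [ht₂', hp₂ (2 * d + 2) (by omega), ht₁, hm₁, Term.eval]
    · have : r ≠ 2 * d + 2 := by omega
      simp [this, hp₂ r (by omega), hp₁ r hr]
  | ite c a b ihc iha ihb =>
    obtain ⟨C, pc, hC⟩ := ihc d
    obtain ⟨P, p, hP⟩ := iha d
    obtain ⟨Q, q, hQ⟩ := ihb d
    refine ⟨.seq C (.ite (2 * d + 2) P Q), pc + (p + q + 1), fun ρ s hρ => ?_⟩
    obtain ⟨s₁, hr₁, hm₁, ht₁, hp₁⟩ := hC ρ s hρ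
    have hρ₁ : ∀ x, s₁.reg (2 * x + 1) = ρ x := fun x => (hp₁ _ (by omega)).trans (hρ x)
    have h0 : s₁.reg 0 = s.reg 0 := hp₁ 0 (by omega)
    by_cases hc : c.eval (s.reg 0) s.mem ρ = 0
    · obtain ⟨s₂, ⟨t₂, hr₂, he₂⟩, hm₂, ht₂, hp₂⟩ := hQ ρ s₁ hρ₁
      rw [h0] at hr₂ ht₂
      refine ⟨s₂, (hr₁.seq (Runs.of_exec (.iteFalse (ht₁.trans hc) he₂))).mono ?_, hm₂.trans hm₁,
        by simpa [Term.eval, hc, hm₁] using ht₂, fun r hr => (hp₂ r hr).trans (hp₁ r hr)⟩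
      simp
      omega
    · obtain ⟨s₂, ⟨t₂, hr₂, he₂⟩, hm₂, ht₂, hp₂⟩ := hP ρ s₁ hρ₁
      rw [h0] at hr₂ ht₂
      refine ⟨s₂, (hr₁.seq (Runs.of_exec (.iteTrue (ht₁ ▸ hc) he₂))).mono ?_, hm₂.trans hm₁,
        by simpa [Term.eval, hc, hm₁] using ht₂, fun r hr => (hp₂ r hr).trans (hp₁ r hr)⟩
      simp
      omega
  | read a ih =>
    obtain ⟨P, p, hP⟩ := ih d
    refine ⟨.seq P (.load (2 * d + 2) (2 * d + 2)), p + 1, fun ρ s hρ => ?_⟩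
    obtain ⟨s₁, hr₁, hm₁, ht₁, hp₁⟩ := hP ρ s hρ
    refine ⟨_, (hr₁.seq (Runs.of_exec (.load _ _ _))).mono (by simp), hm₁,
      by simp [ht₁, hm₁, Term.eval], fun r hr => ?_⟩
    have : r ≠ 2 * d + 2 := by omega
    simp [this, hp₁ r hr]
  | sum x k a ih =>
    obtain ⟨Q, q, hQ⟩ := ih (d + 3)
    obtain ⟨P, p, hP⟩ := exists_for x k (d + 2)
      (.seq Q (.add (2 * d + 2) (2 * d + 2) (2 * d + 8))) (q + 1)
    -- the register of `x` is saved in register `2 * d + 4`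
    refine ⟨.seq (.const (2 * d + 2) 0) (.seq (.add (2 * d + 4) (2 * x + 1) (2 * d + 2))
      (.seq P (.seq (.const (2 * d + 6) 0) (.add (2 * x + 1) (2 * d + 4) (2 * d + 6))))),
      1 + (1 + (p + (1 + 1))), fun ρ s hρ => ?_⟩
    have c1 : 2 * x + 1 ≠ 2 * d + 2 := by omega
    have c2 : 2 * x + 1 ≠ 2 * d + 4 := by omega
    have hinit : ∀ r, r % 2 = 1 ∨ r < 2 * d + 2 → (Function.update (Function.update s.reg
        (2 * d + 2) 0) (2 * d + 4) (s.reg (2 * x + 1))) r = s.reg r := fun r hr => by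
      have e1 : r ≠ 2 * d + 2 := by omega
      have e2 : r ≠ 2 * d + 4 := by omega
      simp [e1, e2]
    have hadd := Exec.add (2 * d + 4) (2 * x + 1) (2 * d + 2)
      { s with reg := Function.update s.reg (2 * d + 2) 0 }
    simp only [Function.update_self, Function.update_of_ne c1, add_zero] at hadd
    obtain ⟨s₁, hr₁, hm₁, h1, h2, h3⟩ := hP
      (fun i s' => s'.mem = s.mem ∧ s'.reg (2 * d + 2) =
          ∑ i ∈ Finset.range i, a.eval (s.reg 0) s.mem (Function.update ρ x i) ∧
        s'.reg (2 * d + 4) = ρ x ∧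
        ∀ r, r ≠ 2 * x + 1 → r % 2 = 1 ∨ r < 2 * d + 2 → s'.reg r = s.reg r)
      ⟨Function.update (Function.update s.reg (2 * d + 2) 0) (2 * d + 4) (s.reg (2 * x + 1)), s.mem⟩
      (fun i s₁ s₂ h hm hreg => ⟨hm.trans h.1, (hreg _ (by omega) (by omega)).trans h.2.1,
        (hreg _ (by omega) (by omega)).trans h.2.2.1,
        fun r hrx hr => (hreg _ hrx (by omega)).trans (h.2.2.2 r hrx hr)⟩)
      (fun i s' hi h hx => by
        simp only [hinit 0 (by omega)]
        have h0 : s'.reg 0 = s.reg 0 := h.2.2.2 0 (by omega) (by omega)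
        obtain ⟨s'', hr, hm, ht, hp⟩ := hQ (Function.update ρ x i) s' fun y => by
          by_cases hy : y = x
          · subst hy
            simp [hx]
          · rw [h.2.2.2 _ (by omega) (by omega), Function.update_of_ne hy, hρ]
        rw [h0] at hr ht
        have ht' : s''.reg (2 * d + 8) = _ := ht
        refine ⟨_, (hr.seq (Runs.of_exec (.add _ _ _ _))).mono (by simp),
          ⟨hm.trans h.1, ?_, ?_, ?_⟩, ?_, ?_⟩
        · simp [ht', h.1, hp (2 * d + 2) (by omega), h.2.1, Finset.sum_range_succ]
        · simp [hp (2 * d + 4) (by omega), h.2.2.1]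
        · intro r hrx hr
          have e1 : r ≠ 2 * d + 2 := by omega
          simp [e1, hp r (by omega), h.2.2.2 r hrx hr]
        · exact (Function.update_of_ne c1 _ _).trans ((hp _ (by omega)).trans hx)
        · simp [hp (2 * (d + 2) + 2) (by omega)])
      ⟨rfl, by simp, by simp [hρ], fun r _ hr => hinit r hr⟩
    have e0 : (Function.update (Function.update s.reg (2 * d + 2) 0) (2 * d + 4)
      (s.reg (2 * x + 1))) 0 = s.reg 0 := hinit 0 (by omega)
    simp only [e0] at hr₁ h1
    refine ⟨_, ((Runs.of_exec (.const _ _ _)).seq ((Runs.of_exec hadd).seq (hr₁.seq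
      ((Runs.of_exec (.const _ _ _)).seq (Runs.of_exec (.add _ _ _ _)))))).mono (by simp), hm₁,
      ?_, fun r hr => ?_⟩
    · simp [c1.symm, h1, Term.eval]
    · have e1 : r ≠ 2 * d + 6 := by omega
      by_cases hrx : r = 2 * x + 1
      · subst hrx
        simp [h2, hρ]
      · simp [e1, hrx, h3 r hrx hr]

/-! ### Table fillings -/

/-- An instruction that, for all values `i < n ^ k` of the variable `0`, in increasing order, stores
the value of `val` in the memory cell with address `addr`. -/
structure Fill where
  /-- the exponent of the number of rounds -/
  k : ℕ
  /-- the address -/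
  addr : Term
  /-- the value that is stored -/
  val : Term

/-- The assignment of `i` to the variable `0`, and of zero to all other variables. -/
def single (i : ℕ) : ℕ → ℕ := Function.update (fun _ => 0) 0 i

/-- The memory after `i` rounds of a table filling that starts from the memory `m`. -/
def Fill.rounds (F : Fill) (n : ℕ) (m : ℕ → ℕ) : ℕ → ℕ → ℕ
  | 0 => m
  | i + 1 => Function.update (F.rounds n m i) (F.addr.eval n (F.rounds n m i) (single i))
      (F.val.eval n (F.rounds n m i) (single i))

/-- The memory after a table filling that starts from the memory `m`. -/
def Fill.run (F : Fill) (n : ℕ) (m : ℕ → ℕ) : ℕ → ℕ := F.rounds n m (n ^ F.k)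

lemma Fill.exists_prog (F : Fill) : ∃ (P : Prog) (p : Polynomial ℕ), ∀ s : State,
    (∀ x, s.reg (2 * x + 1) = 0) → ∃ s', Runs P s (p.eval (s.reg 0)) s' ∧
      s'.mem = F.run (s.reg 0) s.mem ∧ s'.reg 0 = s.reg 0 ∧ ∀ x, s'.reg (2 * x + 1) = 0 := by
  obtain ⟨A, a, hA⟩ := F.addr.exists_computes 1
  obtain ⟨B, b, hB⟩ := F.val.exists_computes 2
  obtain ⟨P, p, hP⟩ := exists_for 0 F.k 0 (.seq A (.seq B (.store 4 6))) (a + (b + 1))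
  refine ⟨.seq P (.const 1 0), p + 1, fun s hs => ?_⟩
  obtain ⟨s₁, hr₁, hm₁, h0, h1⟩ := hP
    (fun i s' => s'.mem = F.rounds (s.reg 0) s.mem i ∧ s'.reg 0 = s.reg 0 ∧
      ∀ x, x ≠ 0 → s'.reg (2 * x + 1) = 0) s
    (fun i s₁ s₂ h hm hreg => ⟨hm.trans h.1, (hreg _ (by omega) (by omega)).trans h.2.1,
      fun x hx => (hreg _ (by omega) (by omega)).trans (h.2.2 x hx)⟩)
    (fun i s' hi h hx => by
      have hρ : ∀ x, s'.reg (2 * x + 1) = single i x := fun x => by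
        by_cases hx0 : x = 0
        · subst hx0
          simpa [single] using hx
        · simpa [single, hx0] using h.2.2 x hx0
      obtain ⟨t, hr, hm, ht, hp⟩ := hA (single i) s' hρ
      obtain ⟨t', hr', hm', ht', hp'⟩ := hB (single i) t fun x => (hp _ (by omega)).trans (hρ x)
      have e0 : t.reg 0 = s'.reg 0 := hp 0 (by omega)
      rw [e0, h.2.1] at hr' ht'
      rw [h.2.1] at hr ht
      have q4 : t'.reg 4 = _ := (hp' 4 (by omega)).trans ht
      have q6 : t'.reg 6 = _ := ht'
      refine ⟨_, (hr.seq (hr'.seq (Runs.of_exec (.store _ _ _)))).mono (by simp), ⟨?_, ?_, ?_⟩,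
        ?_, ?_⟩
      · simp only [q4, q6, hm', hm, h.1]
        rfl
      · exact (hp' 0 (by omega)).trans (e0.trans h.2.1)
      · exact fun x hx => (hp' _ (by omega)).trans ((hp _ (by omega)).trans (h.2.2 x hx))
      · exact (hp' _ (by omega)).trans ((hp _ (by omega)).trans hx)
      · exact (hp' _ (by omega)).trans (hp _ (by omega)))
    ⟨rfl, rfl, fun x _ => hs x⟩
  refine ⟨_, (hr₁.seq (Runs.of_exec (.const _ _ _))).mono (by simp), hm₁, ?_, fun x => ?_⟩
  · simp [h0]
  · by_cases hx : x = 0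
    · simp [hx]
    · simp [hx, h1 x hx]

/-- Every sequence of table fillings, followed by the computation of a term into register `0`, is
carried out by a program in polynomial time. -/
theorem exists_prog_of_fills (Fs : List Fill) (a : Term) :
    ∃ (P : Prog) (p : Polynomial ℕ), ∀ s : State,
      (∀ x, s.reg (2 * x + 1) = 0) → ∃ s', Runs P s (p.eval (s.reg 0)) s' ∧
        s'.mem = Fs.foldl (fun m F => F.run (s.reg 0) m) s.mem ∧
        s'.reg 0 = a.eval (s.reg 0) s'.mem (fun _ => 0) := by
  induction Fs with
  | nil =>
    obtain ⟨P, p, hP⟩ := a.exists_computes 0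
    refine ⟨.seq P (.seq (.const 4 0) (.add 0 2 4)), p + (1 + 1), fun s hs => ?_⟩
    obtain ⟨s₁, hr₁, hm₁, ht₁, -⟩ := hP (fun _ => 0) s hs
    have ht : s₁.reg 2 = _ := ht₁
    exact ⟨_, (hr₁.seq ((Runs.of_exec (.const _ _ _)).seq (Runs.of_exec (.add _ _ _ _)))).mono
      (by simp), hm₁, by simp [ht, hm₁]⟩
  | cons F Fs ih =>
    obtain ⟨P, p, hP⟩ := F.exists_prog
    obtain ⟨Q, q, hQ⟩ := ih
    refine ⟨.seq P Q, p + q, fun s hs => ?_⟩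
    obtain ⟨s₁, hr₁, hm₁, h0, h1⟩ := hP s hs
    obtain ⟨s₂, hr₂, hm₂, ht₂⟩ := hQ s₁ h1
    rw [h0] at hr₂ hm₂ ht₂
    exact ⟨s₂, (hr₁.seq hr₂).mono (by simp), by rw [hm₂, hm₁]; rfl, ht₂⟩

/-- The rule for table fillings: if the addresses are `A 0, A 1, …`, and each round `i` stores a
value that satisfies `R i` provided that the earlier rounds did and that no cell outside of the
table has changed, then the final table satisfies `R`. -/
lemma Fill.run_spec (F : Fill) {n : ℕ} {m : ℕ → ℕ} (A : ℕ → ℕ) (R : ℕ → ℕ → Prop)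
    (hA : ∀ i < n ^ F.k, ∀ j < n ^ F.k, A i = A j → i = j)
    (h : ∀ i < n ^ F.k, ∀ m', (∀ a, (∀ j < n ^ F.k, a ≠ A j) → m' a = m a) →
      (∀ j < i, R j (m' (A j))) →
        F.addr.eval n m' (single i) = A i ∧ R i (F.val.eval n m' (single i))) :
    (∀ i < n ^ F.k, R i (F.run n m (A i))) ∧
      ∀ a, (∀ j < n ^ F.k, a ≠ A j) → F.run n m a = m a := by
  suffices hi : ∀ i ≤ n ^ F.k, (∀ j < i, R j (F.rounds n m i (A j))) ∧
      ∀ a, (∀ j < n ^ F.k, a ≠ A j) → F.rounds n m i a = m a from hi _ le_rfl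
  intro i
  induction i with
  | zero => exact fun _ => ⟨fun j hj => absurd hj (Nat.not_lt_zero j), fun _ _ => rfl⟩
  | succ i ih =>
    intro hi
    obtain ⟨h1, h2⟩ := ih (by omega)
    obtain ⟨e1, e2⟩ := h i (by omega) _ h2 h1
    refine ⟨fun j hj => ?_, fun a ha => ?_⟩
    · rw [Fill.rounds, e1]
      rcases Nat.lt_succ_iff_lt_or_eq.1 hj with hj | rfl
      · rw [Function.update_of_ne fun h => by
          have := hA j (by omega) i (by omega) h
          omega]
        exact h1 j hj
      · rw [Function.update_self]
        exact e2
    · rw [Fill.rounds, e1, Function.update_of_ne (ha i (by omega))]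
      exact h2 a ha

end Ram

/-! ### The auxiliary graph as a graph on numbers -/

namespace SimpleGraph

open Comparability

section Forcing

variable {V : Type*} {G : SimpleGraph V} {c : V → Bool} {L : V → V → Prop}

/-- Two edges of the complement that form an induced `2K₂` with a third one, but not with each
other, lie in the same direction of rotation from the third one. -/
lemma InducesC4.rotation_congr (hc : ∀ u v, u ≠ v → c u = c v → G.Adj u v)
    (hL : ∀ a b a' b', G.InducesC4 a b a' b' → (L a b' ↔ L b a') ∧ (L a b' ↔ ¬ L a' b))
    {a b a₂ b₂ a' b' : V} (h : G.InducesC4 a b a' b') (h₂ : G.InducesC4 a₂ b₂ a' b')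
    (ha : c a = c a₂) (hb : c b = c b₂) (hn : ¬ G.InducesC4 a b a₂ b₂) : L a b' ↔ L a₂ b' := by
  have hab : c a ≠ c b := fun e => h.not_adj (hc _ _ h.ne e)
  have hne : a ≠ b₂ := fun e => hab (e ▸ hb.symm)
  have hne' : a₂ ≠ b := fun e => hab (ha.trans (e ▸ rfl))
  by_cases h1 : G.Adj a b₂
  · have h2 : ¬ G.Adj a₂ b := fun h2 => hn ⟨h.ne, h.not_adj, h₂.ne, h₂.not_adj,
      hc _ _ (fun e => h₂.not_adj (e ▸ h1)) ha, h1, h2.symm,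
      hc _ _ (fun e => h.not_adj (e ▸ h1)) hb⟩
    have h3 : G.InducesC4 a₂ b a' b' :=
      ⟨hne', h2, h.ne', h.not_adj', h₂.aa', h₂.ab', h.ba', h.bb'⟩
    exact (hL _ _ _ _ h).1.trans (hL _ _ _ _ h3).1.symm
  · have h3 : G.InducesC4 a b₂ a' b' :=
      ⟨hne, h1, h.ne', h.not_adj', h.aa', h.ab', h₂.ba', h₂.bb'⟩
    exact (hL _ _ _ _ h3).1.trans (hL _ _ _ _ h₂).1.symm

/-- The end point of `uv` on the side where `c` is `i`. -/
def endOn (c : V → Bool) (i : Bool) (p : V × V) : V := if c p.1 = i then p.1 else p.2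

lemma inducesC4_endOn_iff {p q : V × V} :
    G.InducesC4 (endOn c true p) (endOn c false p) (endOn c true q) (endOn c false q) ↔
      G.InducesC4 p.1 p.2 q.1 q.2 := by
  have h1 : G.InducesC4 p.2 p.1 q.1 q.2 ↔ G.InducesC4 p.1 p.2 q.1 q.2 :=
    ⟨.flip_left, .flip_left⟩
  have h2 : G.InducesC4 p.1 p.2 q.2 q.1 ↔ G.InducesC4 p.1 p.2 q.1 q.2 :=
    ⟨.flip_right, .flip_right⟩
  have h3 : G.InducesC4 p.2 p.1 q.2 q.1 ↔ G.InducesC4 p.1 p.2 q.1 q.2 :=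
    ⟨fun h => h.flip_left.flip_right, fun h => h.flip_left.flip_right⟩
  unfold SimpleGraph.endOn
  cases e1 : c p.1 <;> cases e2 : c q.1 <;> simp_all

lemma apply_endOn {p : V × V} (hp : c p.1 ≠ c p.2) (i : Bool) : c (endOn c i p) = i := by
  unfold SimpleGraph.endOn
  cases e1 : c p.1 <;> cases i <;> rw [e1] at hp <;> simp_all

end Forcing

variable {n : ℕ}

/-- The ordered pair of vertices with the number `e` is an edge of the complement of `G`. -/
def EdgeCode (G : SimpleGraph (Fin n)) (e : ℕ) : Prop :=
  ∃ u v : Fin n, e = n * u + v ∧ u ≠ v ∧ ¬ G.Adj u v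

/-- The ordered pairs of vertices with the numbers `e` and `f` form an induced `2K₂` of the
complement of `G`. In this copy of the auxiliary graph every edge occurs twice, once for each order
of its end points. -/
def AuxCode (G : SimpleGraph (Fin n)) (e f : ℕ) : Prop :=
  ∃ u v u' v' : Fin n, e = n * u + v ∧ f = n * u' + v' ∧ G.InducesC4 u v u' v'

variable {G : SimpleGraph (Fin n)}

lemma fin_code_inj {u v u' v' : Fin n} :
    n * (u : ℕ) + v = n * (u' : ℕ) + v' ↔ u = u' ∧ v = v' := by
  rw [mul_add_inj v.2 v'.2, Fin.ext_iff, Fin.ext_iff]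

lemma fin_code_lt (u v : Fin n) : n * (u : ℕ) + v < n ^ 2 := by
  have := Nat.mul_le_mul_left n (Nat.succ_le_of_lt u.2)
  rw [Nat.mul_succ] at this
  have := v.2
  rw [sq]
  omega

lemma auxCode_iff {u v u' v' : Fin n} :
    AuxCode G (n * u + v) (n * u' + v') ↔ G.InducesC4 u v u' v' := by
  constructor
  · rintro ⟨u₁, v₁, u₁', v₁', h1, h2, h⟩
    obtain ⟨rfl, rfl⟩ := fin_code_inj.1 h1
    obtain ⟨rfl, rfl⟩ := fin_code_inj.1 h2
    exact h
  · exact fun h => ⟨_, _, _, _, rfl, rfl, h⟩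

lemma edgeCode_iff {u v : Fin n} : EdgeCode G (n * u + v) ↔ u ≠ v ∧ ¬ G.Adj u v := by
  constructor
  · rintro ⟨u₁, v₁, h1, h⟩
    obtain ⟨rfl, rfl⟩ := fin_code_inj.1 h1
    exact h
  · exact fun h => ⟨_, _, rfl, h⟩

lemma EdgeCode.lt {e : ℕ} (h : EdgeCode G e) : e < n ^ 2 := by
  obtain ⟨u, v, rfl, -⟩ := h
  exact fin_code_lt u v

lemma AuxCode.symm {e f : ℕ} (h : AuxCode G e f) : AuxCode G f e := by
  obtain ⟨u, v, u', v', rfl, rfl, h⟩ := h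
  exact auxCode_iff.2 h.symm

lemma AuxCode.edgeCode {e f : ℕ} (h : AuxCode G e f) : EdgeCode G e := by
  obtain ⟨u, v, u', v', rfl, rfl, h⟩ := h
  exact edgeCode_iff.2 ⟨h.ne, h.not_adj⟩

lemma not_auxCode_self (e : ℕ) : ¬ AuxCode G e e := by
  rintro ⟨u, v, u', v', h1, h2, h⟩
  obtain ⟨rfl, rfl⟩ := fin_code_inj.1 (h1.symm.trans h2)
  exact h.aa'.ne rfl

/-- The rotations of the four-cycles of `G` give an orientation that the forcing relation of the
auxiliary graph respects. -/
theorem orientable_auxCode (hco : G.IsCoBipartite) (hca : G.IsCircularArcGraph) :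
    Orientable (n ^ 2) (AuxCode G) := by
  obtain ⟨c, hc⟩ := hco.exists_side
  obtain ⟨L, hL⟩ := hca.exists_rotation
  refine ⟨AuxCode.symm, fun h => h.edgeCode.lt, ?_⟩
  have side : ∀ {u v}, u ≠ v → ¬ G.Adj u v → c u ≠ c v := fun h1 h2 h3 => h2 (hc _ _ h1 h3)
  let D : ℕ × ℕ → Prop := fun r => ∃ p q : Fin n × Fin n, r.1 = n * p.1 + p.2 ∧
    r.2 = n * q.1 + q.2 ∧ L (endOn c true p) (endOn c false q)
  have hD : ∀ p q : Fin n × Fin n, D (n * p.1 + p.2, n * q.1 + q.2) ↔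
      L (endOn c true p) (endOn c false q) := by
    refine fun p q => ⟨?_, fun h => ⟨p, q, rfl, rfl, h⟩⟩
    rintro ⟨p', q', h1, h2, h⟩
    obtain rfl : p = p' := Prod.ext_iff.2 (fin_code_inj.1 h1)
    obtain rfl : q = q' := Prod.ext_iff.2 (fin_code_inj.1 h2)
    exact h
  have hanti : ∀ {e f}, AuxCode G e f → (D (e, f) ↔ ¬ D (f, e)) := by
    rintro e f ⟨u, v, u', v', rfl, rfl, h⟩
    rw [hD (u, v) (u', v'), hD (u', v') (u, v)]
    exact (hL _ _ _ _ ((inducesC4_endOn_iff (p := (u, v)) (q := (u', v'))).2 h)).2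
  have hcongr : ∀ {e e' f}, AuxCode G e f → AuxCode G e' f → ¬ AuxCode G e e' →
      (D (e, f) ↔ D (e', f)) := by
    rintro e e' f ⟨u, v, u', v', rfl, rfl, h⟩ ⟨u₂, v₂, u₂', v₂', rfl, h', h₂⟩ hn
    obtain ⟨rfl, rfl⟩ := fin_code_inj.1 h'
    rw [hD (u, v) (u', v'), hD (u₂, v₂) (u', v')]
    have s1 := side h.ne h.not_adj
    have s2 := side h₂.ne h₂.not_adj
    refine InducesC4.rotation_congr hc hL
      ((inducesC4_endOn_iff (p := (u, v)) (q := (u', v'))).2 h)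
      ((inducesC4_endOn_iff (p := (u₂, v₂)) (q := (u', v'))).2 h₂)
      ((apply_endOn (p := (u, v)) s1 _).trans (apply_endOn (p := (u₂, v₂)) s2 _).symm)
      ((apply_endOn (p := (u, v)) s1 _).trans (apply_endOn (p := (u₂, v₂)) s2 _).symm)
      fun hC => hn (auxCode_iff.2 ?_)
    exact (inducesC4_endOn_iff (p := (u, v)) (q := (u₂, v₂))).1 hC
  have hforce : ∀ {p q}, Force (AuxCode G) p q → (D p ↔ D q) := by
    rintro ⟨e, f⟩ ⟨e', f'⟩ ⟨h1, h2, ⟨rfl, h3⟩ | ⟨rfl, h3⟩⟩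
    · rw [hanti h1, hanti h2, hcongr h1.symm h2.symm h3]
    · exact hcongr h1 h2 h3
  intro e f hef hclass
  have hcl : ∀ {p q}, SameClass (AuxCode G) p q → (D p ↔ D q) := by
    intro p q h
    induction h with
    | refl => rfl
    | tail _ h ih => exact ih.trans (hforce h)
  exact iff_not_self ((hcl hclass).symm.trans (hanti hef))

/-! ### Correctness of the colouring and of the interval models -/

/-- The `i`-th maximal independent set of the auxiliary graph, as a relation: the greedy extension
of the set of all edges of height `i`. -/
def levelRel (G : SimpleGraph (Fin n)) (i : ℕ) (u v : Fin n) : Prop :=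
  Greedy (AuxCode G) (EdgeCode G) (HasHeight (n ^ 2) (AuxCode G) (EdgeCode G) i) (n * u + v)

lemma hasHeight_not_adj (hK : Orientable (n ^ 2) (AuxCode G)) (i e f : ℕ)
    (he : HasHeight (n ^ 2) (AuxCode G) (EdgeCode G) i e)
    (hf : HasHeight (n ^ 2) (AuxCode G) (EdgeCode G) i f) : ¬ AuxCode G e f :=
  HasHeight.not_adj hK he hf

lemma isMaxIndepRel_levelRel (hK : Orientable (n ^ 2) (AuxCode G)) (i : ℕ) :
    G.IsMaxIndepRel (levelRel G i) := by
  have hX : ∀ {u v}, levelRel G i u v → u ≠ v ∧ ¬ G.Adj u v :=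
    fun h => edgeCode_iff.1 (greedy_iff.1 h).1
  have hmax : ∀ {u v : Fin n}, u ≠ v → ¬ G.Adj u v → ¬ levelRel G i u v →
      ∃ a b, levelRel G i a b ∧ G.InducesC4 u v a b := by
    intro u v h1 h2 h3
    obtain ⟨f, hf, hef⟩ := exists_adj_of_not_greedy hK.symm (fun _ h => h.1.mem)
      (hasHeight_not_adj hK i) (edgeCode_iff.2 ⟨h1, h2⟩) h3
    obtain ⟨a, b, rfl, -⟩ := hef.symm.edgeCode
    exact ⟨a, b, hf, auxCode_iff.1 hef⟩
  have hind : ∀ {a b a' b' : Fin n}, levelRel G i a b → levelRel G i a' b' →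
      ¬ G.InducesC4 a b a' b' := fun h h' hC =>
    Greedy.not_adj (K := AuxCode G) hK.symm not_auxCode_self h h' (auxCode_iff.2 hC)
  refine ⟨fun {u v} h => ?_, fun h => (hX h).1, fun h => (hX h).2, hind, hmax⟩
  by_contra hn
  obtain ⟨a, b, hab, hC⟩ := hmax (hX h).1.symm (fun e => (hX h).2 e.symm) hn
  exact hind h hab hC.flip_left

/-- The number of levels: the number of `t` for which there is a chain of `t + 1` edges. -/
noncomputable def numLevels (G : SimpleGraph (Fin n)) : ℕ :=
  {t | t < n ^ 2 ∧ ∃ e, ChainEnd (n ^ 2) (AuxCode G) (EdgeCode G) t e}.ncard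

lemma lt_numLevels_iff (hK : Orientable (n ^ 2) (AuxCode G)) {t : ℕ} :
    t < numLevels G ↔ ∃ e, ChainEnd (n ^ 2) (AuxCode G) (EdgeCode G) t e := by
  classical
  let S := {t | t < n ^ 2 ∧ ∃ e, ChainEnd (n ^ 2) (AuxCode G) (EdgeCode G) t e}
  have hS : ∀ t, t ∈ S ↔ ∃ e, ChainEnd (n ^ 2) (AuxCode G) (EdgeCode G) t e :=
    fun t => ⟨fun h => h.2, fun ⟨e, he⟩ => ⟨he.lt hK fun _ h => h.lt, e, he⟩⟩
  have hdown : ∀ t t', t ≤ t' → t' ∈ S → t ∈ S := fun t t' h h' =>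
    let ⟨e, he⟩ := (hS _).1 h'
    (hS _).2 ⟨e, he.mono h⟩
  have hfin : S.Finite := (Set.finite_lt_nat (n ^ 2)).subset fun t h => h.1
  rw [← hS]
  constructor
  · intro h
    by_contra hn
    have : S ⊆ Set.Iio t := fun t' h' => not_le.1 fun hle => hn (hdown _ _ hle h')
    have := Set.ncard_le_ncard this (Set.finite_Iio t)
    rw [Set.ncard_Iio_nat] at this
    exact absurd h (not_lt.2 this)
  · intro h
    have : Set.Iic t ⊆ S := fun t' h' => hdown _ _ h' h
    have := Set.ncard_le_ncard this hfin
    rw [Set.ncard_Iic_nat] at this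
    exact this

/-- The heights form an optimal colouring: a longest chain is a clique whose size is the number of
levels. -/
lemma numLevels_eq_chromaticNumber (hK : Orientable (n ^ 2) (AuxCode G)) :
    (numLevels G : ℕ∞) = Gᶜ.auxGraph.chromaticNumber := by
  apply le_antisymm
  · refine le_iInf₂ fun k hk => ?_
    obtain ⟨c⟩ := hk
    rw [Nat.cast_le]
    rcases Nat.eq_zero_or_pos (numLevels G) with h0 | h0
    · omega
    obtain ⟨e, he⟩ := (lt_numLevels_iff hK).1 (Nat.sub_lt h0 one_pos)
    obtain ⟨s, hs, hsX, -, hsK⟩ := he.exists_clique hK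
    have hex : ∀ f : s, ∃ p : Fin n × Fin n,
        (f : ℕ) = n * p.1 + p.2 ∧ s(p.1, p.2) ∈ Gᶜ.edgeSet := by
      rintro ⟨f, hf⟩
      obtain ⟨u, v, rfl, h⟩ := hsX f hf
      exact ⟨(u, v), rfl, (compl_adj G u v).2 h⟩
    choose p hp hpe using hex
    have hinj : Function.Injective fun f : s => c ⟨_, hpe f⟩ := by
      intro f g hfg
      by_contra hne
      refine c.valid ((auxGraph_compl_adj (hpe f) (hpe g)).2 ?_) hfg
      rw [← auxCode_iff, ← hp, ← hp]
      exact hsK f f.2 g g.2 fun h => hne (Subtype.ext h)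
    have := Fintype.card_le_of_injective _ hinj
    simp only [Fintype.card_coe, Fintype.card_fin, hs] at this
    omega
  · have hex : ∀ e : Gᶜ.edgeSet, ∃ (u v : Fin n) (i : Fin (numLevels G)),
        (e : Sym2 (Fin n)) = s(u, v) ∧
          HasHeight (n ^ 2) (AuxCode G) (EdgeCode G) i (n * u + v) := by
      rintro ⟨e, he⟩
      induction e with
      | _ u v =>
        obtain ⟨i, hi⟩ := exists_hasHeight hK (fun _ h => EdgeCode.lt h)
          (edgeCode_iff.2 ((compl_adj G u v).1 he))
        exact ⟨u, v, ⟨i, (lt_numLevels_iff hK).2 ⟨_, hi.1⟩⟩, rfl, hi⟩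
    choose u v c hp hc using hex
    refine Colorable.chromaticNumber_le ⟨Coloring.mk c fun {e f} hef heq => ?_⟩
    obtain ⟨e', he'⟩ := id e
    have h1 := hc e
    have h2 := hc f
    rw [heq] at h1
    refine h1.not_adj hK h2 (auxCode_iff.2 ?_)
    have he : s(u e, v e) ∈ Gᶜ.edgeSet := hp e ▸ e.2
    have hf : s(u f, v f) ∈ Gᶜ.edgeSet := hp f ▸ f.2
    refine (auxGraph_compl_adj he hf).1 ?_
    convert hef using 1
    · exact Subtype.ext (hp e).symm
    · exact Subtype.ext (hp f).symm

/-- One side of the chain graph `levelRel G i`: the side that contains the first end point `p` of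
the first edge `pq`. Its vertices are joined to `q` or have a neighbour that is joined to `p`. -/
def LevelSide (G : SimpleGraph (Fin n)) (i : ℕ) (v : Fin n) : Prop :=
  ∃ p q : Fin n, levelRel G i p q ∧
    (∀ p' q' : Fin n, n * (p' : ℕ) + q' < n * (p : ℕ) + q → ¬ levelRel G i p' q') ∧
    (levelRel G i v q ∨ ∃ w, levelRel G i v w ∧ levelRel G i w p)

lemma levelSide_spec (hK : Orientable (n ^ 2) (AuxCode G)) (hco : G.IsCoBipartite)
    (hca : G.IsCircularArcGraph) (i : ℕ) :
    (∀ {u v}, levelRel G i u v → (LevelSide G i u ↔ ¬ LevelSide G i v)) ∧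
      ∀ {a b a' b'}, LevelSide G i a → LevelSide G i a' → levelRel G i a b → levelRel G i a' b' →
        levelRel G i a b' ∨ levelRel G i a' b := by
  obtain ⟨c, hc⟩ := hco.exists_side
  obtain ⟨L, hL⟩ := hca.exists_rotation
  have hm := isMaxIndepRel_levelRel hK i
  have hchain : ∀ {a b a' b'}, levelRel G i a b → levelRel G i a' b' → c a = c a' → _ :=
    fun h h' => hm.chain hc (fun a b a' b' h => (hL a b a' b' h).2) h h'
  have side : ∀ {u v}, levelRel G i u v → c u ≠ c v := fun h e => hm.not_adj h (hc _ _ (hm.ne h) e)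
  by_cases hex : ∃ u v, levelRel G i u v
  · obtain ⟨u, v, huv⟩ := hex
    obtain ⟨⟨p, q⟩, hpq, hmin⟩ := (measure fun r : Fin n × Fin n => n * (r.1 : ℕ) + r.2).wf.has_min
      {r | levelRel G i r.1 r.2} ⟨(u, v), huv⟩
    have key : ∀ v, LevelSide G i v ↔
        levelRel G i v q ∨ ∃ w, levelRel G i v w ∧ levelRel G i w p := by
      refine fun v => ⟨?_, fun h => ⟨p, q, hpq, fun p' q' hlt h' => hmin (p', q') h' hlt, h⟩⟩
      rintro ⟨p', q', hpq', hmin', h⟩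
      have h1 := not_lt.1 fun h => hmin' p q h hpq
      have h2 : n * (p : ℕ) + q ≤ n * (p' : ℕ) + q' := not_lt.1 (hmin (p', q') hpq')
      obtain ⟨rfl, rfl⟩ := fin_code_inj.1 (le_antisymm h1 h2)
      exact h
    have hside : ∀ {v}, LevelSide G i v → c v = c p := by
      intro v h
      rcases (key v).1 h with h | ⟨w, h1, h2⟩
      · exact Bool.eq_of_ne_of_ne (side h) (side hpq)
      · exact Bool.eq_of_ne_of_ne (side h1) (side h2).symm
    have hside' : ∀ {u v}, levelRel G i u v → c u = c p → LevelSide G i u := by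
      intro u v h hu
      rcases hchain h hpq hu with h' | h'
      · exact (key u).2 (Or.inl h')
      · exact (key u).2 (Or.inr ⟨v, h, hm.symm h'⟩)
    refine ⟨fun {u v} h => ⟨fun h1 h2 => side h ((hside h1).trans (hside h2).symm), fun h1 => ?_⟩,
      fun h h' h1 h2 => hchain h1 h2 ((hside h).trans (hside h').symm)⟩
    refine hside' h ?_
    by_contra hu
    exact h1 (hside' (hm.symm h) (Bool.eq_of_ne_of_ne (side h).symm (Ne.symm hu)))
  · exact ⟨fun h => absurd ⟨_, _, h⟩ hex, fun _ _ h => absurd ⟨_, _, h⟩ hex⟩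

/-- The interval models of the complements of the levels form an optimal box representation. -/
theorem isOptimalBoxRepresentation_levels (hco : G.IsCoBipartite) (hca : G.IsCircularArcGraph)
    {k : ℕ} (hk : k = numLevels G) {l r : Fin k → Fin n → ℝ}
    (hl : ∀ i v, l i v = chainLeft (levelRel G i) (LevelSide G i) v)
    (hr : ∀ i v, r i v = chainRight (levelRel G i) (LevelSide G i) v) :
    (∀ i v, l i v < r i v) ∧
      G.IsOptimalBoxRepresentation fun i => intervalModelGraph (l i) (r i) := by
  have hK := orientable_auxCode hco hca
  refine ⟨fun i v => ?_, ?_, ?_⟩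
  · rw [hl, hr, Nat.cast_lt]
    exact chainLeft_lt_chainRight v
  · refine isBoxRepresentation_of_isMaxIndepRel hco hca (m := fun i => levelRel G i)
      (fun i => isMaxIndepRel_levelRel hK i) (fun i u v => ?_) fun u v hne hna => ?_
    · have e1 : l i = fun v => (chainLeft (levelRel G i) (LevelSide G i) v : ℝ) := funext (hl i)
      have e2 : r i = fun v => (chainRight (levelRel G i) (LevelSide G i) v : ℝ) := funext (hr i)
      rw [e1, e2]
      exact intervalModelGraph_chain_adj (m := levelRel G i) (A := LevelSide G i)
        (isMaxIndepRel_levelRel hK i).symm (levelSide_spec hK hco hca i).1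
        (levelSide_spec hK hco hca i).2 u v
    · have he := edgeCode_iff.2 ⟨hne, hna⟩
      obtain ⟨i, hi⟩ := exists_hasHeight hK (fun _ h => EdgeCode.lt h) he
      refine ⟨⟨i, hk ▸ (lt_numLevels_iff hK).2 ⟨_, hi.1⟩⟩, ?_⟩
      exact .of_mem hK.symm (fun _ h => h.1.mem) (hasHeight_not_adj hK i) hi
  · rw [boxicity_eq_chromaticNumber hco hca, hk, numLevels_eq_chromaticNumber hK]

end SimpleGraph

/-! ### Implication classes, computed by bounded iteration -/

namespace Comparability

/-- The forcing relation on the numbers of pairs of numbers below `n ^ 2`. -/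
def ForceCode (n : ℕ) (K : ℕ → ℕ → Prop) (x y : ℕ) : Prop :=
  ∃ e < n ^ 2, ∃ f < n ^ 2, ∃ g < n ^ 2,
    x = n ^ 2 * e + f ∧ y = n ^ 2 * e + g ∧ K e f ∧ K e g ∧ ¬ K f g ∨
    x = n ^ 2 * f + e ∧ y = n ^ 2 * g + e ∧ K f e ∧ K g e ∧ ¬ K f g

/-- The pair with the number `y` is reached from the one with the number `x` in `t` forcing steps.
-/
def ReachIn (n : ℕ) (K : ℕ → ℕ → Prop) : ℕ → ℕ → ℕ → Prop
  | 0, x, y => x = y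
  | t + 1, x, y => ∃ z < n ^ 4, ReachIn n K t x z ∧ ForceCode n K z y

variable {n : ℕ} {K : ℕ → ℕ → Prop}

lemma code_lt {N a b : ℕ} {p : ℕ × ℕ} (h1 : p.1 < n ^ a) (h2 : p.2 < n ^ b) (hN : N = n ^ b) :
    code N p < n ^ (a + b) := by
  subst hN
  have := Nat.mul_le_mul_left (n ^ b) (Nat.succ_le_of_lt h1)
  rw [Nat.mul_succ] at this
  rw [pow_add, mul_comm (n ^ a), code]
  omega

lemma forceCode_code_iff (hK : Orientable (n ^ 2) K) {p : ℕ × ℕ} (hp : K p.1 p.2) {y : ℕ} :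
    ForceCode n K (code (n ^ 2) p) y ↔ ∃ q, Force K p q ∧ y = code (n ^ 2) q := by
  have l1 := hK.lt hp
  have l2 := hK.lt (hK.symm hp)
  constructor
  · rintro ⟨e, he, f, hf, g, hg, ⟨h1, h2, h3, h4, h5⟩ | ⟨h1, h2, h3, h4, h5⟩⟩
    · obtain ⟨e1, e2⟩ := (mul_add_inj l2 hf).1 h1
      exact ⟨(e, g), ⟨hp, h4, Or.inl ⟨e1, e2 ▸ h5⟩⟩, h2⟩
    · obtain ⟨e1, e2⟩ := (mul_add_inj l2 he).1 h1
      exact ⟨(g, e), ⟨hp, h4, Or.inr ⟨e2, e1 ▸ h5⟩⟩, h2⟩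
  · rintro ⟨⟨e, f⟩, ⟨-, h, ⟨h1, h2⟩ | ⟨h1, h2⟩⟩, rfl⟩
    · exact ⟨p.1, l1, p.2, l2, f, hK.lt (hK.symm h), Or.inl ⟨rfl, by rw [h1]; rfl, hp,
        by rw [h1]; exact h, h2⟩⟩
    · exact ⟨p.2, l2, p.1, l1, e, hK.lt h, Or.inr ⟨rfl, by rw [h1]; rfl, hp,
        by rw [h1]; exact h, h2⟩⟩

lemma ReachIn.sameClass (hK : Orientable (n ^ 2) K) {p : ℕ × ℕ} (hp : K p.1 p.2) {t y : ℕ}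
    (h : ReachIn n K t (code (n ^ 2) p) y) : ∃ q, SameClass K p q ∧ y = code (n ^ 2) q := by
  induction t generalizing y with
  | zero => exact ⟨p, .refl, h.symm⟩
  | succ t ih =>
    obtain ⟨z, -, hz, hzy⟩ := h
    obtain ⟨q, hq, rfl⟩ := ih hz
    obtain ⟨r, hr, rfl⟩ := (forceCode_code_iff hK (hq.adj hp)).1 hzy
    exact ⟨r, hq.tail hr, rfl⟩

lemma SameClass.exists_reachIn (hK : Orientable (n ^ 2) K) {p q : ℕ × ℕ} (hp : K p.1 p.2)
    (h : SameClass K p q) : ∃ t, ReachIn n K t (code (n ^ 2) p) (code (n ^ 2) q) := by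
  induction h with
  | refl => exact ⟨0, rfl⟩
  | @tail q r hq hqr ih =>
    obtain ⟨t, ht⟩ := ih
    have hKq := SameClass.adj hq hp
    exact ⟨t + 1, _, code_lt (a := 2) (b := 2) (hK.lt hKq) (hK.lt (hK.symm hKq)) rfl, ht,
      (forceCode_code_iff hK hKq).2 ⟨r, hqr, rfl⟩⟩

/-- A shortest sequence of forcing steps visits every number at most once and so has fewer than
`n ^ 4` steps. -/
lemma ReachIn.exists_lt {x y t : ℕ} (hy : y < n ^ 4) (h : ReachIn n K t x y) :
    ∃ t < n ^ 4, ReachIn n K t x y := by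
  classical
  have hex : ∃ t, ReachIn n K t x y := ⟨t, h⟩
  refine ⟨Nat.find hex, ?_, Nat.find_spec hex⟩
  have hdown : ∀ d s y, y < n ^ 4 → ReachIn n K (s + d) x y →
      (∀ r < s + d, ¬ ReachIn n K r x y) →
      ∃ z < n ^ 4, ReachIn n K s x z ∧ ∀ r < s, ¬ ReachIn n K r x z := by
    intro d
    induction d with
    | zero => exact fun s y hy h hmin => ⟨y, hy, h, hmin⟩
    | succ d ih =>
      rintro s y hy ⟨z, hz, hxz, hzy⟩ hmin
      exact ih s z hz hxz fun r hr hxz' => hmin (r + 1) (by omega) ⟨z, hz, hxz', hzy⟩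
  have hz : ∀ s : Fin (Nat.find hex + 1), ∃ z : Fin (n ^ 4), ReachIn n K s x z ∧
      ∀ r < (s : ℕ), ¬ ReachIn n K r x z := by
    intro s
    have hs : (s : ℕ) + (Nat.find hex - s) = Nat.find hex := by omega
    obtain ⟨z, hz, hz'⟩ := hdown (Nat.find hex - s) s y hy (by rw [hs]; exact Nat.find_spec hex)
      (by rw [hs]; exact fun r hr => Nat.find_min hex hr)
    exact ⟨⟨z, hz⟩, hz'⟩
  choose z hz hz' using hz
  have hinj : Function.Injective z := by
    intro s s' hss
    by_contra hne
    rcases lt_or_gt_of_ne (Fin.val_ne_of_ne hne) with hlt | hlt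
    · exact hz' s' s hlt (hss ▸ hz s)
    · exact hz' s s' hlt (hss ▸ hz s')
  have := Fintype.card_le_of_injective _ hinj
  simp only [Fintype.card_fin] at this
  omega

/-- The lexicographic orientation in terms of bounded iterations of the forcing relation. -/
lemma pos_iff_reachIn (hK : Orientable (n ^ 2) K) {e f : ℕ} : Pos (n ^ 2) K e f ↔
    K e f ∧ ∃ x < n ^ 4, (∃ t < n ^ 4, ReachIn n K t (n ^ 2 * e + f) x) ∧
      ∀ y < n ^ 4, (∃ t < n ^ 4, ReachIn n K t (n ^ 2 * f + e) y) → x < y := by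
  refine and_congr_right fun hef => ?_
  have hlt : ∀ {e f q}, K e f → SameClass K (e, f) q → code (n ^ 2) q < n ^ 4 := fun h hq =>
    code_lt (a := 2) (b := 2) (hK.lt (hq.adj h)) (hK.lt (hK.symm (hq.adj h))) rfl
  constructor
  · rintro ⟨q, hq, hmin⟩
    obtain ⟨t, ht⟩ := hq.exists_reachIn hK hef
    refine ⟨_, hlt hef hq, ht.exists_lt (hlt hef hq), ?_⟩
    rintro y - ⟨t, -, ht⟩
    obtain ⟨q', hq', rfl⟩ := ReachIn.sameClass hK (p := (f, e)) (hK.symm hef) ht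
    exact hmin q' hq'
  · rintro ⟨x, -, ⟨t, -, ht⟩, hmin⟩
    obtain ⟨q, hq, rfl⟩ := ReachIn.sameClass hK (p := (e, f)) hef ht
    refine ⟨q, hq, fun q' hq' => ?_⟩
    obtain ⟨t, ht⟩ := hq'.exists_reachIn hK (hK.symm hef)
    exact hmin _ (hlt (hK.symm hef) hq') (ht.exists_lt (hlt (hK.symm hef) hq'))

end Comparability

/-! ### Terms for bounded formulas and tables -/

namespace Ram

open Comparability

namespace Term

/-- A term, read as a formula, holds if its value is not zero. -/
def Holds (n : ℕ) (m : ℕ → ℕ) (a : Term) (ρ : ℕ → ℕ) : Prop := a.eval n m ρ ≠ 0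

/-- Negation. -/
def not (a : Term) : Term := .ite a (.lit 0) (.lit 1)

/-- Conjunction. -/
def and (a b : Term) : Term := .ite a b (.lit 0)

/-- Disjunction. -/
def or (a b : Term) : Term := .ite a (.lit 1) b

/-- Implication. -/
def imp (a b : Term) : Term := .or (.not a) b

/-- The formula `a < b`. -/
def lt (a b : Term) : Term := .sub b a

/-- The formula `a = b`. -/
def eq (a b : Term) : Term := .not (.or (.lt a b) (.lt b a))

/-- The formula `∃ x < n ^ k, a`. -/
def ex (x k : ℕ) (a : Term) : Term := .sum x k a

/-- The formula `∀ x < n ^ k, a`. -/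
def all (x k : ℕ) (a : Term) : Term := .not (.ex x k (.not a))

/-- The truth value of a formula, as a number. -/
def bool (a : Term) : Term := .ite a (.lit 1) (.lit 0)

/-- The product of `n ^ k` and `a`; the variable `100` must not occur in `a`. -/
def mulPow (k : ℕ) (a : Term) : Term := .sum 100 k a

/-- The number `n ^ k * a + b` of the pair `(a, b)`; the variable `100` must not occur in `a`. -/
def pair (k : ℕ) (a b : Term) : Term := .add (.mulPow k a) b

/-- The entry of table `j` with index `a`. Table `j` takes up the memory cells from `n ^ 12 * j` on;
the largest table, that of the forcing steps, has `n ^ 12` entries. -/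
def tab (j : ℕ) (a : Term) : Term := .read (.pair 12 (.lit j) a)

variable {n : ℕ} {m ρ : ℕ → ℕ} {a b c : Term}

@[simp] lemma holds_not : a.not.Holds n m ρ ↔ ¬ a.Holds n m ρ := by
  simp [Holds, not, eval]

@[simp] lemma holds_and : (a.and b).Holds n m ρ ↔ a.Holds n m ρ ∧ b.Holds n m ρ := by
  by_cases h : a.eval n m ρ = 0 <;> simp [Holds, and, eval, h]

@[simp] lemma holds_or : (a.or b).Holds n m ρ ↔ a.Holds n m ρ ∨ b.Holds n m ρ := by
  by_cases h : a.eval n m ρ = 0 <;> simp [Holds, or, eval, h]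

@[simp] lemma holds_imp : (a.imp b).Holds n m ρ ↔ (a.Holds n m ρ → b.Holds n m ρ) := by
  simp [imp, imp_iff_not_or]

@[simp] lemma holds_lt : (a.lt b).Holds n m ρ ↔ a.eval n m ρ < b.eval n m ρ := by
  simp only [Holds, lt, eval]
  omega

@[simp] lemma holds_eq : (a.eq b).Holds n m ρ ↔ a.eval n m ρ = b.eval n m ρ := by
  simp only [eq, holds_not, holds_or, holds_lt]
  omega

@[simp] lemma holds_ex {x k : ℕ} :
    (a.ex x k).Holds n m ρ ↔ ∃ i < n ^ k, a.Holds n m (Function.update ρ x i) := by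
  simp [Holds, ex, eval, Finset.sum_eq_zero_iff]

@[simp] lemma holds_all {x k : ℕ} :
    (a.all x k).Holds n m ρ ↔ ∀ i < n ^ k, a.Holds n m (Function.update ρ x i) := by
  simp [all]

@[simp] lemma holds_tab {j : ℕ} : (tab j a).Holds n m ρ ↔ m (n ^ 12 * j + a.eval n m ρ) ≠ 0 := by
  simp [Holds, tab, pair, mulPow, eval]

open Classical in
@[simp] lemma eval_bool : a.bool.eval n m ρ = if a.Holds n m ρ then 1 else 0 := by
  by_cases h : a.eval n m ρ = 0 <;> simp [bool, eval, h, Holds]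

open Classical in
lemma eval_ite : (Term.ite c a b).eval n m ρ =
    if c.Holds n m ρ then a.eval n m ρ else b.eval n m ρ := by
  by_cases h : c.eval n m ρ = 0 <;> simp [eval, h, Holds]

lemma eval_pair {k : ℕ} (h : ∀ i, a.eval n m (Function.update ρ 100 i) = a.eval n m ρ) :
    (pair k a b).eval n m ρ = n ^ k * a.eval n m ρ + b.eval n m ρ := by
  simp [pair, mulPow, eval, h]

end Term

/-- A table filling for table `j`, whose entry with the number of the pair `(e, f)`, for `e < n ^ a`
and `f < n ^ b`, is given by the formula `body`, where `e` and `f` are the values of the variables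
`1` and `2`. -/
def Fill.table (j a b : ℕ) (body : Term) : Fill where
  k := a + b
  addr := .pair 12 (.lit j) (.var 0)
  val := .ex 1 a (.ex 2 b (.and (.eq (.var 0) (.pair b (.var 1) (.var 2))) body))

/-- The assignment of `i`, `e` and `f` to the variables `0`, `1` and `2`. -/
def env (i e f : ℕ) : ℕ → ℕ := Function.update (Function.update (single i) 1 e) 2 f

/-- The table `j` of the memory `m` holds the relation `R` between numbers below `n ^ a` and
numbers below `n ^ b`. -/
def Stored (n : ℕ) (m : ℕ → ℕ) (j a b : ℕ) (R : ℕ → ℕ → Prop) : Prop :=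
  ∀ e < n ^ a, ∀ f < n ^ b, (m (n ^ 12 * j + (n ^ b * e + f)) ≠ 0 ↔ R e f)

/-- The memories `m` and `m'` agree on table `j`. -/
def SameTable (n : ℕ) (m m' : ℕ → ℕ) (j : ℕ) : Prop :=
  ∀ i < n ^ 12, m' (n ^ 12 * j + i) = m (n ^ 12 * j + i)

lemma pair_lt_pow {n a b e f : ℕ} (he : e < n ^ a) (hf : f < n ^ b) :
    n ^ b * e + f < n ^ (a + b) := code_lt (p := (e, f)) he hf rfl

lemma pow_le_pow_of_lt {n a b i : ℕ} (h : i < n ^ a) (ha : 0 < a) (hab : a ≤ b) :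
    n ^ a ≤ n ^ b := by
  refine Nat.pow_le_pow_right (Nat.pos_of_ne_zero ?_) hab
  rintro rfl
  rw [zero_pow ha.ne'] at h
  exact absurd h (Nat.not_lt_zero i)

lemma Stored.of_sameTable {n : ℕ} {m m' : ℕ → ℕ} {j a b : ℕ} {R : ℕ → ℕ → Prop}
    (h : Stored n m j a b R) (hs : SameTable n m m' j) (ha : 0 < a) (hab : a + b ≤ 12) :
    Stored n m' j a b R := fun e he f hf => by
  have hlt := pair_lt_pow he hf
  rw [hs _ (hlt.trans_le (pow_le_pow_of_lt hlt (by omega) hab))]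
  exact h e he f hf

lemma Fill.table_spec {n : ℕ} {m : ℕ → ℕ} {j a b : ℕ} {body : Term} {R : ℕ → ℕ → Prop}
    (ha : 0 < a) (hab : a + b ≤ 12)
    (h : ∀ e < n ^ a, ∀ f < n ^ b, ∀ m', (∀ j', j' ≠ j → SameTable n m m' j') →
      (∀ e' < n ^ a, ∀ f' < n ^ b, n ^ b * e' + f' < n ^ b * e + f →
        (m' (n ^ 12 * j + (n ^ b * e' + f')) ≠ 0 ↔ R e' f')) →
      (body.Holds n m' (env (n ^ b * e + f) e f) ↔ R e f)) :
    Stored n ((Fill.table j a b body).run n m) j a b R ∧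
      ∀ j', j' ≠ j → SameTable n m ((Fill.table j a b body).run n m) j' := by
  have hdec : ∀ i < n ^ (a + b), ∃ e < n ^ a, ∃ f < n ^ b, i = n ^ b * e + f := by
    intro i hi
    have hpos : 0 < n ^ b := by
      rcases Nat.eq_zero_or_pos (n ^ b) with h | h
      · rw [pow_add, h] at hi
        omega
      · exact h
    refine ⟨i / n ^ b, ?_, i % n ^ b, Nat.mod_lt _ hpos, (Nat.div_add_mod i _).symm⟩
    exact Nat.div_lt_of_lt_mul (by rwa [mul_comm, ← pow_add])
  obtain ⟨h1, h2⟩ := Fill.run_spec (Fill.table j a b body) (n := n) (m := m)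
    (fun i => n ^ 12 * j + i)
    (fun i v => ∀ e < n ^ a, ∀ f < n ^ b, i = n ^ b * e + f → (v ≠ 0 ↔ R e f))
    (fun i _ i' _ h => Nat.add_left_cancel h) (fun i hi m' hm' hlow => by
      obtain ⟨e, he, f, hf, rfl⟩ := hdec i hi
      have hle : n ^ (a + b) ≤ n ^ 12 := pow_le_pow_of_lt hi (by omega) hab
      refine ⟨?_, ?_⟩
      · rw [Fill.table, Term.eval_pair fun _ => rfl]
        rfl
      · intro e' he' f' hf' heq
        obtain ⟨rfl, rfl⟩ := (mul_add_inj hf hf').1 heq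
        rw [← h e he f hf m' ?_ ?_]
        · have : ∀ x y, ((Term.var 0).eq (.pair b (.var 1) (.var 2))).Holds n m'
              (Function.update (Function.update (single (n ^ b * e + f)) 1 x) 2 y) ↔
              n ^ b * e + f = n ^ b * x + y := fun x y => by
            rw [Term.holds_eq, Term.eval_pair fun _ => by simp [Term.eval]]
            simp [Term.eval, single]
          change Term.Holds _ _ _ _ ↔ _
          simp only [Fill.table, Term.holds_ex, Term.holds_and, this]
          constructor
          · rintro ⟨x, hx, y, hy, hxy, hb⟩
            obtain ⟨rfl, rfl⟩ := (mul_add_inj hf hy).1 hxy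
            exact hb
          · exact fun hb => ⟨e, he, f, hf, rfl, hb⟩
        · intro j' hj' i hi'
          refine hm' _ fun x hx heq => hj' ?_
          exact ((mul_add_inj hi' (hx.trans_le hle)).1 heq).1
        · exact fun e' he' f' hf' hlt => hlow _ hlt e' he' f' hf' rfl)
  refine ⟨fun e he f hf => h1 _ (pair_lt_pow he hf) e he f hf rfl, fun j' hj' i hi => h2 _ ?_⟩
  intro x hx heq
  have hle : n ^ (a + b) ≤ n ^ 12 := pow_le_pow_of_lt hx (by omega) hab
  exact hj' ((mul_add_inj hi (hx.trans_le hle)).1 heq).1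

/-! ### The program -/

namespace Boxicity

open Term

/-- The vertices held by the variables `x` and `y` are adjacent; table `0` is the input. -/
def adjT (x y : ℕ) : Term := .tab 0 (.pair 1 (.var x) (.var y))

/-- The pair of vertices held by the variables `x` and `y` is an edge of the complement. -/
def nonadjT (x y : ℕ) : Term := .and (.not (.eq (.var x) (.var y))) (.not (adjT x y))

/-- The value of the variable `x` is the number of an edge of the complement. -/
def edgeT (x : ℕ) : Term :=
  .ex 11 1 (.ex 12 1 (.and (.eq (.var x) (.pair 1 (.var 11) (.var 12))) (nonadjT 11 12)))

/-- Table `3`: the auxiliary graph. The numbers `1` and `2` are left out: the end points of the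
intervals are stored in the first `2 * n ^ 3` cells, which lie below table `3` even for `n = 1`. -/
def auxFill : Fill := .table 3 2 2 <|
  .ex 3 1 <| .ex 4 1 <| .ex 5 1 <| .ex 6 1 <|
    .and (.eq (.var 1) (.pair 1 (.var 3) (.var 4))) <|
    .and (.eq (.var 2) (.pair 1 (.var 5) (.var 6))) <|
    .and (nonadjT 3 4) <| .and (nonadjT 5 6) <|
    .and (adjT 3 5) <| .and (adjT 3 6) <| .and (adjT 4 5) (adjT 4 6)

/-- The pair held by the variables `x` and `y` is an edge of the auxiliary graph. -/
def auxT (x y : ℕ) : Term := .tab 3 (.pair 2 (.var x) (.var y))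

/-- The forcing relation between the values of the variables `x` and `y`. -/
def forceT (x y : ℕ) : Term :=
  .ex 6 2 <| .ex 7 2 <| .ex 8 2 <| .or
    (.and (.eq (.var x) (.pair 2 (.var 6) (.var 7))) <|
      .and (.eq (.var y) (.pair 2 (.var 6) (.var 8))) <|
      .and (auxT 6 7) <| .and (auxT 6 8) <| .not (auxT 7 8))
    (.and (.eq (.var x) (.pair 2 (.var 7) (.var 6))) <|
      .and (.eq (.var y) (.pair 2 (.var 8) (.var 6))) <|
      .and (auxT 7 6) <| .and (auxT 8 6) <| .not (auxT 7 8))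

/-- Table `4`: the pairs that can be reached from each other in a given number of forcing steps. -/
def stepsFill : Fill := .table 4 4 8 <|
  .ex 3 4 <| .ex 4 4 <| .and (.eq (.var 2) (.pair 4 (.var 3) (.var 4))) <| .or
    (.and (.eq (.var 1) (.lit 0)) (.eq (.var 3) (.var 4)))
    (.and (.lt (.lit 0) (.var 1)) <| .ex 5 4 <|
      .and (.tab 4 (.pair 8 (.sub (.var 1) (.lit 1)) (.pair 4 (.var 3) (.var 5)))) (forceT 5 4))

/-- Table `5`: the implication classes. -/
def classFill : Fill := .table 5 4 4 <|
  .ex 3 4 <| .tab 4 (.pair 8 (.var 3) (.pair 4 (.var 1) (.var 2)))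

/-- Table `6`: the lexicographic orientation. -/
def orientFill : Fill := .table 6 2 2 <|
  .and (auxT 1 2) <| .ex 3 4 <|
    .and (.tab 5 (.pair 4 (.pair 2 (.var 1) (.var 2)) (.var 3))) <|
    .all 4 4 <| .imp (.tab 5 (.pair 4 (.pair 2 (.var 2) (.var 1)) (.var 4))) (.lt (.var 3) (.var 4))

/-- Table `7`: the ends of the chains with a given number of elements. -/
def chainFill : Fill := .table 7 2 2 <|
  .and (edgeT 2) <| .or (.eq (.var 1) (.lit 0)) <|
    .and (.lt (.lit 0) (.var 1)) <| .ex 3 2 <|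
    .and (.tab 7 (.pair 2 (.sub (.var 1) (.lit 1)) (.var 3))) (.tab 6 (.pair 2 (.var 3) (.var 2)))

/-- The edge held by the variable `3` has the height held by the variable `1`. A chain has at most
`n ^ 2` elements, and table `7` is not consulted for longer ones. -/
def heightT : Term :=
  .and (.tab 7 (.pair 2 (.var 1) (.var 3))) <| .not <|
    .and (.lt (.add (.var 1) (.lit 1)) (.mulPow 2 (.lit 1)))
      (.tab 7 (.pair 2 (.add (.var 1) (.lit 1)) (.var 3)))

/-- Table `8`: the greedy extensions of the sets of edges of a given height. -/
def levelFill : Fill := .table 8 2 2 <|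
  .and (edgeT 2) <| .and
    (.all 3 2 <| .imp heightT (.not (auxT 2 3)))
    (.all 3 2 <| .imp (.and (.lt (.var 3) (.var 2)) (.tab 8 (.pair 2 (.var 1) (.var 3))))
      (.not (auxT 2 3)))

/-- The pair of the vertices held by `x` and `y` belongs to the level held by the variable `1`. -/
def levelT (x y : ℕ) : Term := .tab 8 (.pair 2 (.var 1) (.pair 1 (.var x) (.var y)))

/-- Table `9`: the sides of the levels. -/
def sideFill : Fill := .table 9 2 1 <|
  .ex 3 1 <| .ex 4 1 <| .and (levelT 3 4) <| .and
    (.all 5 1 <| .all 6 1 <| .imp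
      (.lt (.pair 1 (.var 5) (.var 6)) (.pair 1 (.var 3) (.var 4))) (.not (levelT 5 6))) <|
    .or (levelT 2 4) <| .ex 7 1 <| .and (levelT 2 7) (levelT 7 3)

/-- The vertex held by the variable `x` belongs to the side of the level held by the variable `1`.
-/
def sideT (x : ℕ) : Term := .tab 9 (.pair 1 (.var 1) (.var x))

/-- An instruction that stores, for each level `i` and each vertex `v`, the value of `body` at the
address `2 * (i * n + v) + r`; here `i` and `v` are the values of the variables `1` and `2`. -/
def outputFill (r : ℕ) (body : Term) : Fill where
  k := 3
  addr := .add (.add (.var 0) (.var 0)) (.lit r)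
  val := .sum 1 2 (.sum 2 1 (.ite (.eq (.var 0) (.pair 1 (.var 1) (.var 2))) body (.lit 0)))

/-- The left end point. -/
def leftT : Term :=
  .ite (sideT 2) (.lit 0) (.add (.sum 3 1 (.bool (levelT 3 2))) (.lit 1))

/-- The right end point. -/
def rightT : Term :=
  .ite (sideT 2)
    (.add (.sum 3 1 (.bool (.and (sideT 3) (.ex 4 1 (.and (levelT 3 4) (.not (levelT 2 4)))))))
      (.lit 1))
    (.add (.mulPow 1 (.lit 1)) (.lit 2))

/-- The number of levels. -/
def numLevelsT : Term := .sum 1 2 (.bool (.ex 2 2 (.tab 7 (.pair 2 (.var 1) (.var 2)))))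

end Boxicity

end Ram

namespace Ram

namespace Boxicity

open Term Comparability SimpleGraph

/-! ### Correctness of the program -/

section Correctness

variable {n : ℕ} {G : SimpleGraph (Fin n)} {m : ℕ → ℕ}

/-- The memory holds the adjacency matrix of `G` as table `0`. -/
def HasInput (G : SimpleGraph (Fin n)) (m : ℕ → ℕ) : Prop :=
  ∀ u v : Fin n, m (n ^ 12 * 0 + (n * u + v)) ≠ 0 ↔ G.Adj u v

lemma HasInput.of_sameTable {m' : ℕ → ℕ} (h : HasInput G m) (hs : SameTable n m m' 0) :
    HasInput G m' := fun u v => by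
  have hlt := fin_code_lt u v
  rw [hs _ (hlt.trans_le (pow_le_pow_of_lt hlt (by omega) (by omega)))]
  exact h u v

lemma holds_nonadjT (h : HasInput G m) {ρ : ℕ → ℕ} {x y : ℕ} {u v : Fin n} (hx : x ≠ 100)
    (hu : ρ x = u) (hv : ρ y = v) : (nonadjT x y).Holds n m ρ ↔ u ≠ v ∧ ¬ G.Adj u v := by
  have e := h u v
  simp only [nonadjT, adjT, holds_and, holds_not, holds_eq, holds_tab, pair, mulPow, Term.eval,
    Function.update_of_ne hx, Finset.sum_const, Finset.card_range, smul_eq_mul, hu, hv, pow_one]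
  rw [e, Fin.val_inj]

lemma holds_adjT (h : HasInput G m) {ρ : ℕ → ℕ} {x y : ℕ} {u v : Fin n} (hx : x ≠ 100)
    (hu : ρ x = u) (hv : ρ y = v) : (adjT x y).Holds n m ρ ↔ G.Adj u v := by
  have e := h u v
  simp only [adjT, holds_tab, pair, mulPow, Term.eval, Function.update_of_ne hx, Finset.sum_const,
    Finset.card_range, smul_eq_mul, hu, hv, pow_one]
  exact e

lemma auxFill_spec (h : HasInput G m) : Stored n (auxFill.run n m) 3 2 2 (AuxCode G) ∧
    ∀ j, j ≠ 3 → SameTable n m (auxFill.run n m) j := by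
  refine Fill.table_spec (by omega) (by omega) fun e he f hf m' hm' _ => ?_
  have h' := h.of_sameTable (hm' 0 (by omega))
  simp only [holds_ex, holds_and, holds_eq, pow_one, pair, mulPow, Term.eval, env, single,
    Function.update_apply, Finset.sum_const, Finset.card_range, smul_eq_mul, Nat.reduceEqDiff,
    reduceIte]
  constructor
  · rintro ⟨u, hu, v, hv, u', hu', v', hv', h1, h2, h3, h4, h5, h6, h7, h8⟩
    rw [holds_nonadjT h' (u := ⟨u, hu⟩) (v := ⟨v, hv⟩) (by omega) rfl rfl] at h3
    rw [holds_nonadjT h' (u := ⟨u', hu'⟩) (v := ⟨v', hv'⟩) (by omega) rfl rfl] at h4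
    rw [holds_adjT h' (u := ⟨u, hu⟩) (v := ⟨u', hu'⟩) (by omega) rfl rfl] at h5
    rw [holds_adjT h' (u := ⟨u, hu⟩) (v := ⟨v', hv'⟩) (by omega) rfl rfl] at h6
    rw [holds_adjT h' (u := ⟨v, hv⟩) (v := ⟨u', hu'⟩) (by omega) rfl rfl] at h7
    rw [holds_adjT h' (u := ⟨v, hv⟩) (v := ⟨v', hv'⟩) (by omega) rfl rfl] at h8
    exact ⟨_, _, _, _, h1, h2, h3.1, h3.2, h4.1, h4.2, h5, h6, h7, h8⟩
  · rintro ⟨u, v, u', v', h1, h2, hC⟩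
    exact ⟨u, u.2, v, v.2, u', u'.2, v', v'.2, h1, h2,
      (holds_nonadjT h' (by omega) rfl rfl).2 ⟨hC.ne, hC.not_adj⟩,
      (holds_nonadjT h' (by omega) rfl rfl).2 ⟨hC.ne', hC.not_adj'⟩,
      (holds_adjT h' (by omega) rfl rfl).2 hC.aa', (holds_adjT h' (by omega) rfl rfl).2 hC.ab',
      (holds_adjT h' (by omega) rfl rfl).2 hC.ba', (holds_adjT h' (by omega) rfl rfl).2 hC.bb'⟩

lemma stepsFill_spec {K : ℕ → ℕ → Prop} (h : Stored n m 3 2 2 K) :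
    Stored n (stepsFill.run n m) 4 4 8 (fun t x => ∃ y < n ^ 4, ∃ z < n ^ 4, x = n ^ 4 * y + z ∧
      ReachIn n K t y z) ∧ ∀ j, j ≠ 4 → SameTable n m (stepsFill.run n m) j := by
  refine Fill.table_spec (by omega) (by omega) fun t ht x hx m' hm' hlow => ?_
  have h' := h.of_sameTable (hm' 3 (by omega)) (by omega) (by omega)
  simp only [holds_ex, holds_and, holds_eq, holds_or, forceT, auxT, holds_tab, holds_not,
    holds_lt, pair, mulPow, Term.eval, env, single, Function.update_apply, Finset.sum_const,
    Finset.card_range, smul_eq_mul, Nat.reduceEqDiff, reduceIte]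
  refine exists_congr fun y => and_congr_right fun hy => exists_congr fun z =>
    and_congr_right fun hz => and_congr_right fun _ => ?_
  cases t with
  | zero => simp [ReachIn]
  | succ t =>
    simp only [Nat.succ_ne_zero, false_and, false_or, Nat.succ_pos, true_and, Nat.add_sub_cancel]
    refine exists_congr fun w => and_congr_right fun hw => and_congr ?_ ?_
    · have hlt : n ^ 4 * y + w < n ^ 8 := pair_lt_pow hy hw
      rw [hlow t (by omega) _ hlt (by rw [Nat.mul_succ]; omega)]
      constructor
      · rintro ⟨y', _, w', hw', heq, hr⟩
        obtain ⟨rfl, rfl⟩ := (mul_add_inj hw hw').1 heq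
        exact hr
      · exact fun hr => ⟨y, hy, w, hw, rfl, hr⟩
    · refine exists_congr fun e => and_congr_right fun he => exists_congr fun f =>
        and_congr_right fun hf => exists_congr fun g => and_congr_right fun hg => ?_
      rw [h' e he f hf, h' e he g hg, h' f hf e he, h' g hg e he, h' f hf g hg]

lemma classFill_spec {K : ℕ → ℕ → Prop}
    (h : Stored n m 4 4 8 (fun t x => ∃ y < n ^ 4, ∃ z < n ^ 4, x = n ^ 4 * y + z ∧
      ReachIn n K t y z)) :
    Stored n (classFill.run n m) 5 4 4 (fun x y => ∃ t < n ^ 4, ReachIn n K t x y) ∧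
      ∀ j, j ≠ 5 → SameTable n m (classFill.run n m) j := by
  refine Fill.table_spec (by omega) (by omega) fun x hx y hy m' hm' _ => ?_
  have h' := h.of_sameTable (hm' 4 (by omega)) (by omega) (by omega)
  simp only [holds_ex, holds_tab, pair, mulPow, Term.eval, env, single, Function.update_apply,
    Finset.sum_const, Finset.card_range, smul_eq_mul, Nat.reduceEqDiff, reduceIte]
  refine exists_congr fun t => and_congr_right fun ht => ?_
  rw [h' t ht _ (pair_lt_pow hx hy)]
  constructor
  · rintro ⟨x', _, y', hy', heq, hr⟩
    obtain ⟨rfl, rfl⟩ := (mul_add_inj hy hy').1 heq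
    exact hr
  · exact fun hr => ⟨x, hx, y, hy, rfl, hr⟩

lemma orientFill_spec {K : ℕ → ℕ → Prop} (hK : Orientable (n ^ 2) K) (h : Stored n m 3 2 2 K)
    (hc : Stored n m 5 4 4 (fun x y => ∃ t < n ^ 4, ReachIn n K t x y)) :
    Stored n (orientFill.run n m) 6 2 2 (Pos (n ^ 2) K) ∧
      ∀ j, j ≠ 6 → SameTable n m (orientFill.run n m) j := by
  refine Fill.table_spec (by omega) (by omega) fun e he f hf m' hm' _ => ?_
  have h' := h.of_sameTable (hm' 3 (by omega)) (by omega) (by omega)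
  have hc' := hc.of_sameTable (hm' 5 (by omega)) (by omega) (by omega)
  simp only [holds_ex, holds_and, holds_tab, auxT, holds_all, holds_imp, holds_lt, pair, mulPow,
    Term.eval, env, single, Function.update_apply, Finset.sum_const, Finset.card_range,
    smul_eq_mul, Nat.reduceEqDiff, reduceIte]
  rw [pos_iff_reachIn hK, h' e he f hf]
  refine and_congr_right fun _ => exists_congr fun x => and_congr_right fun hx => ?_
  rw [hc' _ (pair_lt_pow he hf) x hx]
  refine and_congr_right fun _ => forall_congr' fun y => forall_congr' fun hy => ?_
  rw [hc' _ (pair_lt_pow hf he) y hy]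

lemma holds_edgeT (h : HasInput G m) {ρ : ℕ → ℕ} {x : ℕ} (hx : x < 11) :
    (edgeT x).Holds n m ρ ↔ EdgeCode G (ρ x) := by
  have h1 : x ≠ 11 := by omega
  have h2 : x ≠ 12 := by omega
  simp only [edgeT, holds_ex, holds_and, holds_eq, pow_one, h1, h2, pair, mulPow, Term.eval,
    Function.update_apply, Finset.sum_const, Finset.card_range, smul_eq_mul,
    Nat.reduceEqDiff, reduceIte]
  constructor
  · rintro ⟨u, hu, v, hv, he, hn⟩
    exact ⟨⟨u, hu⟩, ⟨v, hv⟩, he, (holds_nonadjT h (by omega) rfl rfl).1 hn⟩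
  · rintro ⟨u, v, he, hn⟩
    exact ⟨u, u.2, v, v.2, he, (holds_nonadjT h (by omega) rfl rfl).2 hn⟩

lemma chainFill_spec (h : HasInput G m) (hp : Stored n m 6 2 2 (Pos (n ^ 2) (AuxCode G))) :
    Stored n (chainFill.run n m) 7 2 2 (ChainEnd (n ^ 2) (AuxCode G) (EdgeCode G)) ∧
      ∀ j, j ≠ 7 → SameTable n m (chainFill.run n m) j := by
  refine Fill.table_spec (by omega) (by omega) fun t ht e he m' hm' hlow => ?_
  have h' := h.of_sameTable (hm' 0 (by omega))
  have hp' := hp.of_sameTable (hm' 6 (by omega)) (by omega) (by omega)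
  rw [holds_and, holds_edgeT h' (by omega)]
  simp only [holds_ex, holds_and, holds_or, holds_eq, holds_lt, holds_tab, pair, mulPow,
    Term.eval, env, single, Function.update_apply, Finset.sum_const, Finset.card_range,
    smul_eq_mul, Nat.reduceEqDiff, reduceIte]
  cases t with
  | zero => simp [ChainEnd]
  | succ t =>
    simp only [Nat.succ_ne_zero, false_or, Nat.succ_pos, true_and, Nat.add_sub_cancel]
    refine and_congr_right fun _ => ⟨?_, ?_⟩
    · rintro ⟨f, hf, h1, h2⟩
      rw [hlow t (by omega) f hf (by rw [Nat.mul_succ]; omega)] at h1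
      exact ⟨f, h1, (hp' f hf e he).1 h2⟩
    · rintro ⟨f, h1, h2⟩
      have hf := h1.mem.lt
      exact ⟨f, hf, (hlow t (by omega) f hf (by rw [Nat.mul_succ]; omega)).2 h1,
        (hp' f hf e he).2 h2⟩

lemma holds_heightT (hK : Orientable (n ^ 2) (AuxCode G))
    (h : Stored n m 7 2 2 (ChainEnd (n ^ 2) (AuxCode G) (EdgeCode G))) {ρ : ℕ → ℕ}
    (hi : ρ 1 < n ^ 2) (hf : ρ 3 < n ^ 2) :
    heightT.Holds n m ρ ↔ HasHeight (n ^ 2) (AuxCode G) (EdgeCode G) (ρ 1) (ρ 3) := by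
  simp only [heightT, holds_and, holds_not, holds_lt, holds_tab, mul_one, pair, mulPow, Term.eval,
    Function.update_apply, Finset.sum_const, Finset.card_range, smul_eq_mul,
    Nat.reduceEqDiff, reduceIte]
  rw [h _ hi _ hf]
  refine and_congr_right fun _ => not_congr ⟨fun ⟨h1, h2⟩ => (h _ h1 _ hf).1 h2, fun h1 => ?_⟩
  have h2 := h1.lt hK fun _ h => h.lt
  exact ⟨h2, (h _ h2 _ hf).2 h1⟩

lemma levelFill_spec (hK : Orientable (n ^ 2) (AuxCode G)) (h : HasInput G m)
    (ha : Stored n m 3 2 2 (AuxCode G))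
    (hc : Stored n m 7 2 2 (ChainEnd (n ^ 2) (AuxCode G) (EdgeCode G))) :
    Stored n (levelFill.run n m) 8 2 2 (fun i => Greedy (AuxCode G) (EdgeCode G)
      (HasHeight (n ^ 2) (AuxCode G) (EdgeCode G) i)) ∧
      ∀ j, j ≠ 8 → SameTable n m (levelFill.run n m) j := by
  refine Fill.table_spec (by omega) (by omega) fun i hi e he m' hm' hlow => ?_
  have h' := h.of_sameTable (hm' 0 (by omega))
  have ha' := ha.of_sameTable (hm' 3 (by omega)) (by omega) (by omega)
  have hc' := hc.of_sameTable (hm' 7 (by omega)) (by omega) (by omega)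
  rw [holds_and, holds_edgeT h' (by omega), holds_and, greedy_iff]
  refine and_congr_right fun _ => and_congr ?_ ?_
  · rw [holds_all]
    refine ⟨fun H f hf => ?_, fun H f hf => ?_⟩
    · have hlt := hf.1.mem.lt
      have := H f hlt
      rw [holds_imp, holds_heightT hK hc' hi hlt] at this
      have := this hf
      simp only [auxT, holds_not, holds_tab, pair, mulPow, Term.eval, env, single,
        Function.update_apply, Finset.sum_const, Finset.card_range, smul_eq_mul, Nat.reduceEqDiff,
        reduceIte] at this
      rwa [ha' e he f hlt] at this
    · rw [holds_imp, holds_heightT hK hc' hi hf]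
      intro hf'
      have := H f hf'
      simp only [auxT, holds_not, holds_tab, pair, mulPow, Term.eval, env, single,
        Function.update_apply, Finset.sum_const, Finset.card_range, smul_eq_mul, Nat.reduceEqDiff,
        reduceIte]
      rwa [ha' e he f hf]
  · simp only [holds_all, holds_imp, holds_and, holds_lt, auxT, holds_not, holds_tab, pair,
      mulPow, Term.eval, env, single, Function.update_apply, Finset.sum_const, Finset.card_range,
      smul_eq_mul, Nat.reduceEqDiff, reduceIte]
    refine ⟨fun H f hfe hf => ?_, fun H f hf hfe => ?_⟩
    · have hlt : f < n ^ 2 := hfe.trans he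
      rw [← ha' e he f hlt]
      exact H f hlt ⟨hfe, (hlow i hi f hlt (by omega)).2 hf⟩
    · rw [ha' e he f hf]
      exact H f hfe.1 ((hlow i hi f hf (by omega)).1 hfe.2)

/-- The memory holds the levels as table `8`. -/
def HasLevels (G : SimpleGraph (Fin n)) (m : ℕ → ℕ) : Prop :=
  Stored n m 8 2 2 (fun i => Greedy (AuxCode G) (EdgeCode G)
    (HasHeight (n ^ 2) (AuxCode G) (EdgeCode G) i))

lemma holds_levelT (h : HasLevels G m) {ρ : ℕ → ℕ} {x y : ℕ} {u v : Fin n} (hi : ρ 1 < n ^ 2)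
    (hx : x ≠ 100) (hu : ρ x = u) (hv : ρ y = v) :
    (levelT x y).Holds n m ρ ↔ levelRel G (ρ 1) u v := by
  simp only [levelT, holds_tab, pow_one, hx, hu, hv, pair, mulPow, Term.eval,
    Function.update_apply, Finset.sum_const, Finset.card_range, smul_eq_mul, Nat.reduceEqDiff,
    reduceIte]
  exact h _ hi _ (fin_code_lt u v)

lemma sideFill_spec (h : HasLevels G m) :
    Stored n (sideFill.run n m) 9 2 1 (fun i v => ∃ u : Fin n, u = v ∧ LevelSide G i u) ∧
      ∀ j, j ≠ 9 → SameTable n m (sideFill.run n m) j := by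
  refine Fill.table_spec (by omega) (by omega) fun i hi v hv m' hm' _ => ?_
  rw [pow_one] at hv
  have h' : HasLevels G m' := h.of_sameTable (hm' 8 (by omega)) (by omega) (by omega)
  have hlev : ∀ {ρ : ℕ → ℕ} {x y : ℕ} (u v : Fin n), ρ 1 = i → x ≠ 100 → ρ x = u → ρ y = v →
      ((levelT x y).Holds n m' ρ ↔ levelRel G i u v) := by
    rintro ρ x y u v rfl hx hu hv
    exact holds_levelT h' hi hx hu hv
  have hex : (∃ u : Fin n, u = v ∧ LevelSide G i u) ↔ LevelSide G i ⟨v, hv⟩ :=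
    ⟨fun ⟨u, hu, h⟩ => (Fin.ext hu : u = ⟨v, hv⟩) ▸ h, fun h => ⟨_, rfl, h⟩⟩
  rw [hex]
  simp only [holds_ex, holds_and, holds_or, holds_all, holds_imp, holds_not, holds_lt, pow_one,
    pair, mulPow, Term.eval, env, single, Function.update_apply, Finset.sum_const,
    Finset.card_range, smul_eq_mul, Nat.reduceEqDiff, reduceIte]
  constructor
  · rintro ⟨p, hp, q, hq, h1, h2, h3⟩
    refine ⟨⟨p, hp⟩, ⟨q, hq⟩, (hlev _ _ rfl (by omega) rfl rfl).1 h1, fun p' q' hlt hn =>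
      h2 p' p'.2 q' q'.2 hlt ((hlev _ _ rfl (by omega) rfl rfl).2 hn), ?_⟩
    rcases h3 with h3 | ⟨w, hw, h3, h4⟩
    · exact Or.inl ((hlev ⟨v, hv⟩ _ rfl (by omega) rfl rfl).1 h3)
    · exact Or.inr ⟨⟨w, hw⟩, (hlev ⟨v, hv⟩ _ rfl (by omega) rfl rfl).1 h3,
        (hlev ⟨w, hw⟩ ⟨p, hp⟩ rfl (by omega) rfl rfl).1 h4⟩
  · rintro ⟨p, q, h1, h2, h3⟩
    refine ⟨p, p.2, q, q.2, (hlev p q rfl (by omega) rfl rfl).2 h1, fun p' hp' q' hq' hlt hn =>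
      h2 ⟨p', hp'⟩ ⟨q', hq'⟩ hlt ((hlev _ _ rfl (by omega) rfl rfl).1 hn), ?_⟩
    rcases h3 with h3 | ⟨w, h3, h4⟩
    · exact Or.inl ((hlev ⟨v, hv⟩ q rfl (by omega) rfl rfl).2 h3)
    · exact Or.inr ⟨w, w.2, (hlev ⟨v, hv⟩ w rfl (by omega) rfl rfl).2 h3,
        (hlev w p rfl (by omega) rfl rfl).2 h4⟩

/-- The memory holds the sides of the levels as table `9`. -/
def HasSides (G : SimpleGraph (Fin n)) (m : ℕ → ℕ) : Prop :=
  Stored n m 9 2 1 (fun i v => ∃ u : Fin n, u = v ∧ LevelSide G i u)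

lemma holds_sideT (h : HasSides G m) {ρ : ℕ → ℕ} {x : ℕ} {u : Fin n} (hi : ρ 1 < n ^ 2)
    (hu : ρ x = u) : (sideT x).Holds n m ρ ↔ LevelSide G (ρ 1) u := by
  have h1 := h _ hi u (by rw [pow_one]; exact u.2)
  rw [pow_one] at h1
  simp only [sideT, holds_tab, pow_one, hu, pair, mulPow, Term.eval,
    Function.update_apply, Finset.sum_const, Finset.card_range, smul_eq_mul, Nat.reduceEqDiff,
    reduceIte]
  rw [h1]
  exact ⟨fun ⟨v, hv, h⟩ => Fin.ext hv ▸ h, fun h => ⟨u, rfl, h⟩⟩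

lemma outputFill_spec {r : ℕ} (hr : r < 2) {body : Term} {val : ℕ → ℕ → ℕ}
    (h : ∀ i < n ^ 2, ∀ v < n, ∀ m', (∀ j, 3 ≤ j → SameTable n m m' j) →
      body.eval n m' (env (n * i + v) i v) = val i v) :
    (∀ i < n ^ 2, ∀ v < n, (outputFill r body).run n m (2 * (n * i + v) + r) = val i v) ∧
      (∀ j, 3 ≤ j → SameTable n m ((outputFill r body).run n m) j) ∧
      ∀ a, a % 2 ≠ r → (outputFill r body).run n m a = m a := by
  have hout : ∀ j, 3 ≤ j → ∀ i, ∀ x < n ^ 3, n ^ 12 * j + i ≠ 2 * x + r := by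
    intro j hj i x hx heq
    have h1 : n ^ 3 ≤ n ^ 12 := pow_le_pow_of_lt hx (by omega) (by omega)
    have h2 := Nat.mul_le_mul_left (n ^ 12) hj
    omega
  have hlt : ∀ i < n ^ 2, ∀ v < n, n * i + v < n ^ 3 := fun i hi v hv => by
    simpa only [pow_one] using pair_lt_pow (b := 1) hi (by rwa [pow_one])
  obtain ⟨h1, h2⟩ := Fill.run_spec (outputFill r body) (n := n) (m := m) (fun x => 2 * x + r)
    (fun x w => ∀ i < n ^ 2, ∀ v < n, x = n * i + v → w = val i v)
    (fun i _ i' _ h => by simpa using h) (fun x hx m' hm' _ => by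
      refine ⟨?_, ?_⟩
      · simp only [outputFill, Term.eval, single, Function.update_self]
        omega
      · rintro i hi v hv rfl
        have hm'' : ∀ j, 3 ≤ j → SameTable n m m' j := fun j hj i' _ =>
          hm' _ fun x hx => hout j hj i' x hx
        have key : ∀ i' v', v' < n → (Term.ite (.eq (.var 0) (.pair 1 (.var 1) (.var 2))) body
            (.lit 0)).eval n m' (env (n * i + v) i' v') =
              if i' = i then (if v' = v then val i v else 0) else 0 := by
          intro i' v' hv'
          rw [eval_ite]
          simp only [holds_eq, pow_one, pair, mulPow, Term.eval, env, single,
            Function.update_apply, Finset.sum_const, Finset.card_range, smul_eq_mul,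
            Nat.reduceEqDiff, reduceIte]
          by_cases heq : i' = i ∧ v' = v
          · obtain ⟨rfl, rfl⟩ := heq
            simpa [env, single] using h i' hi v' hv m' hm''
          · rw [if_neg fun h => heq ?_]
            · split_ifs with h1 h2
              · exact absurd ⟨h1, h2⟩ heq
              · rfl
              · rfl
            · exact ((mul_add_inj hv' hv).1 h.symm)
        have hsum : ((outputFill r body).val.eval n m' (single (n * i + v))) =
            ∑ i' ∈ Finset.range (n ^ 2), ∑ v' ∈ Finset.range n,
              if i' = i then (if v' = v then val i v else 0) else 0 := by
          simp only [outputFill, Term.eval, pow_one]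
          exact Finset.sum_congr rfl fun i' _ => Finset.sum_congr rfl fun v' hv' =>
            key i' v' (Finset.mem_range.1 hv')
        rw [hsum, Finset.sum_eq_single i, Finset.sum_eq_single v]
        · simp
        · intro b _ hb
          simp [hb]
        · intro hb
          exact absurd (Finset.mem_range.2 hv) hb
        · intro b _ hb
          simp [hb]
        · intro hb
          exact absurd (Finset.mem_range.2 hi) hb)
  refine ⟨fun i hi v hv => h1 _ (hlt i hi v hv) i hi v hv rfl, fun j hj i _ => h2 _ (hout j hj i),
    fun a ha => h2 a fun x _ heq => ha ?_⟩
  omega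

open Classical in
lemma sum_range_ite_eq_ncard {N : ℕ} {P : ℕ → Prop} {Q : Fin N → Prop}
    (h : ∀ x : Fin N, P x ↔ Q x) :
    ∑ x ∈ Finset.range N, (if P x then 1 else 0) = {x | Q x}.ncard := by
  rw [Finset.sum_range, Set.ncard_eq_toFinset_card']
  simp [h]

lemma eval_leftT (hl : HasLevels G m) (hs : HasSides G m) {i x : ℕ} (hi : i < n ^ 2) (v : Fin n) :
    leftT.eval n m (env x i v) = chainLeft (levelRel G i) (LevelSide G i) v := by
  classical
  rw [leftT, eval_ite, chainLeft]
  refine if_congr (holds_sideT hs (u := v) hi rfl) rfl ?_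
  simp only [Term.eval, pow_one, eval_bool]
  rw [sum_range_ite_eq_ncard (Q := fun x => levelRel G i x v)]
  intro y
  exact holds_levelT hl hi (by omega) rfl rfl

lemma eval_rightT (hl : HasLevels G m) (hs : HasSides G m) {i x : ℕ} (hi : i < n ^ 2) (v : Fin n) :
    rightT.eval n m (env x i v) = chainRight (levelRel G i) (LevelSide G i) v := by
  classical
  rw [rightT, eval_ite, chainRight]
  refine if_congr (holds_sideT hs (u := v) hi rfl) ?_ ?_
  · simp only [Term.eval, pow_one, eval_bool]
    rw [sum_range_ite_eq_ncard
      (Q := fun x => LevelSide G i x ∧ ∃ w, levelRel G i x w ∧ ¬ levelRel G i v w)]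
    intro y
    rw [holds_and, holds_sideT hs (u := y) hi rfl, holds_ex, pow_one]
    refine and_congr_right fun _ => ⟨?_, ?_⟩
    · rintro ⟨w, hw, h⟩
      rw [holds_and, holds_not, holds_levelT hl (u := y) (v := ⟨w, hw⟩) hi (by omega) rfl rfl,
        holds_levelT hl (u := v) (v := ⟨w, hw⟩) hi (by omega) rfl rfl] at h
      exact ⟨⟨w, hw⟩, h⟩
    · rintro ⟨w, h⟩
      refine ⟨w, w.2, ?_⟩
      rw [holds_and, holds_not, holds_levelT hl (u := y) (v := w) hi (by omega) rfl rfl,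
        holds_levelT hl (u := v) (v := w) hi (by omega) rfl rfl]
      exact h
  · simp [Term.eval, mulPow]

lemma eval_numLevelsT (h : Stored n m 7 2 2 (ChainEnd (n ^ 2) (AuxCode G) (EdgeCode G))) :
    numLevelsT.eval n m (fun _ => 0) = numLevels G := by
  classical
  have hP : ∀ t < n ^ 2, ((Term.ex 2 2 (.tab 7 (.pair 2 (.var 1) (.var 2)))).Holds n m
      (Function.update (fun _ => 0) 1 t) ↔ ∃ e, ChainEnd (n ^ 2) (AuxCode G) (EdgeCode G) t e) := by
    intro t ht
    simp only [holds_ex, holds_tab, pair, mulPow, Term.eval, Function.update_apply,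
      Finset.sum_const, Finset.card_range, smul_eq_mul, Nat.reduceEqDiff, reduceIte]
    exact ⟨fun ⟨e, he, h'⟩ => ⟨e, (h t ht e he).1 h'⟩,
      fun ⟨e, h'⟩ => ⟨e, h'.mem.lt, (h t ht e h'.mem.lt).2 h'⟩⟩
  have hset : {t | t < n ^ 2 ∧ ∃ e, ChainEnd (n ^ 2) (AuxCode G) (EdgeCode G) t e} =
      ((Finset.range (n ^ 2)).filter fun t =>
        ∃ e, ChainEnd (n ^ 2) (AuxCode G) (EdgeCode G) t e : Finset ℕ) := by
    ext t
    simp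
  rw [numLevels, hset, Set.ncard_coe_finset, Finset.card_filter, numLevelsT]
  simp only [Term.eval, eval_bool]
  exact Finset.sum_congr rfl fun t ht => if_congr (hP t (Finset.mem_range.1 ht)) rfl rfl

/-- The table fillings that compute an optimal box representation. -/
def fills : List Fill :=
  [auxFill, stepsFill, classFill, orientFill, chainFill, levelFill, sideFill,
    outputFill 0 leftT, outputFill 1 rightT]

theorem fills_spec (hK : Orientable (n ^ 2) (AuxCode G)) (h : HasInput G m) {m' : ℕ → ℕ}
    (hm' : m' = fills.foldl (fun m F => F.run n m) m) :
    (∀ i < n ^ 2, ∀ v : Fin n,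
      m' (2 * (n * i + v)) = chainLeft (levelRel G i) (LevelSide G i) v ∧
      m' (2 * (n * i + v) + 1) = chainRight (levelRel G i) (LevelSide G i) v) ∧
      numLevelsT.eval n m' (fun _ => 0) = numLevels G := by
  simp only [fills, List.foldl_cons, List.foldl_nil] at hm'
  obtain ⟨t3, p3⟩ := auxFill_spec h
  have h := h.of_sameTable (p3 0 (by omega))
  generalize auxFill.run n m = m1 at *
  obtain ⟨t4, p4⟩ := stepsFill_spec t3
  have h := h.of_sameTable (p4 0 (by omega))
  have t3 := t3.of_sameTable (p4 3 (by omega)) (by omega) (by omega)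
  generalize stepsFill.run n m1 = m2 at *
  obtain ⟨t5, p5⟩ := classFill_spec t4
  have h := h.of_sameTable (p5 0 (by omega))
  have t3 := t3.of_sameTable (p5 3 (by omega)) (by omega) (by omega)
  generalize classFill.run n m2 = m3 at *
  obtain ⟨t6, p6⟩ := orientFill_spec hK t3 t5
  have h := h.of_sameTable (p6 0 (by omega))
  have t3 := t3.of_sameTable (p6 3 (by omega)) (by omega) (by omega)
  generalize orientFill.run n m3 = m4 at *
  obtain ⟨t7, p7⟩ := chainFill_spec h t6
  have h := h.of_sameTable (p7 0 (by omega))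
  have t3 := t3.of_sameTable (p7 3 (by omega)) (by omega) (by omega)
  generalize chainFill.run n m4 = m5 at *
  obtain ⟨t8, p8⟩ := levelFill_spec hK h t3 t7
  have t7 := t7.of_sameTable (p8 7 (by omega)) (by omega) (by omega)
  generalize levelFill.run n m5 = m6 at *
  obtain ⟨t9, p9⟩ := sideFill_spec t8
  have t7 := t7.of_sameTable (p9 7 (by omega)) (by omega) (by omega)
  have t8 := t8.of_sameTable (p9 8 (by omega)) (by omega) (by omega)
  generalize sideFill.run n m6 = m7 at *
  obtain ⟨hl, pl, -⟩ := outputFill_spec (n := n) (m := m7) (r := 0) (by omega) (body := leftT)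
    (val := fun i v => leftT.eval n m7 (env (n * i + v) i v)) fun i hi v hv m' hm' => by
      have t8' : HasLevels G m' := t8.of_sameTable (hm' 8 (by omega)) (by omega) (by omega)
      have t9' : HasSides G m' := t9.of_sameTable (hm' 9 (by omega)) (by omega) (by omega)
      exact (eval_leftT t8' t9' hi ⟨v, hv⟩).trans (eval_leftT t8 t9 hi ⟨v, hv⟩).symm
  have hl' : ∀ i < n ^ 2, ∀ v : Fin n, _ = chainLeft (levelRel G i) (LevelSide G i) v :=
    fun i hi v => (hl i hi v v.2).trans (eval_leftT t8 t9 hi v)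
  have t7 := t7.of_sameTable (pl 7 (by omega)) (by omega) (by omega)
  have t8 := t8.of_sameTable (pl 8 (by omega)) (by omega) (by omega)
  have t9 := t9.of_sameTable (pl 9 (by omega)) (by omega) (by omega)
  generalize (outputFill 0 leftT).run n m7 = m8 at *
  obtain ⟨hr, pr, qr⟩ := outputFill_spec (n := n) (m := m8) (r := 1) (by omega) (body := rightT)
    (val := fun i v => rightT.eval n m8 (env (n * i + v) i v)) fun i hi v hv m' hm' => by
      have t8' : HasLevels G m' := t8.of_sameTable (hm' 8 (by omega)) (by omega) (by omega)
      have t9' : HasSides G m' := t9.of_sameTable (hm' 9 (by omega)) (by omega) (by omega)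
      exact (eval_rightT t8' t9' hi ⟨v, hv⟩).trans (eval_rightT t8 t9 hi ⟨v, hv⟩).symm
  have t7 := t7.of_sameTable (pr 7 (by omega)) (by omega) (by omega)
  subst hm'
  refine ⟨fun i hi v => ⟨?_, ?_⟩, eval_numLevelsT t7⟩
  · rw [qr _ (by omega)]
    exact hl' i hi v
  · exact (hr i hi v v.2).trans (eval_rightT t8 t9 hi v)

end Correctness

end Boxicity

end Ram

/-! ### Boxicity in polynomial time -/

namespace Ram

namespace Boxicity

open SimpleGraph

lemma hasInput_graphInput {n : ℕ} (G : SimpleGraph (Fin n)) : HasInput G (graphInput G).mem := by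
  intro u v
  have hiff : (∃ u' v' : Fin n, G.Adj u' v' ∧ n ^ 12 * 0 + (n * u + v) = (u' : ℕ) * n + v') ↔
      G.Adj u v := by
    constructor
    · rintro ⟨u', v', h, heq⟩
      rw [mul_zero, zero_add, mul_comm (u' : ℕ)] at heq
      obtain ⟨rfl, rfl⟩ := fin_code_inj.1 heq
      exact h
    · exact fun h => ⟨u, v, h, by rw [mul_zero, zero_add, mul_comm]⟩
  rw [← hiff]
  simp [graphInput]

/-- One program computes an optimal box representation and, in register `0`, its dimension. -/
theorem exists_prog_isOptimalBoxRepresentation :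
    ∃ (P : Prog) (p : Polynomial ℕ), ∀ (n : ℕ) (G : SimpleGraph (Fin n)),
      G.IsCoBipartite ∧ G.IsCircularArcGraph → ∃ (t : ℕ) (s : State),
        Exec P (graphInput G) t s ∧ t ≤ p.eval n ∧ OutputsOptimalBoxRepresentation n G s := by
  obtain ⟨P, p, hP⟩ := exists_prog_of_fills fills numLevelsT
  refine ⟨P, p, fun n G ⟨hco, hca⟩ => ?_⟩
  have hK := orientable_auxCode hco hca
  have hn : (graphInput G).reg 0 = n := rfl
  obtain ⟨s, ⟨t, ht, hexec⟩, hmem, hreg⟩ := hP (graphInput G) fun x => by simp [graphInput]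
  rw [hn] at ht hmem hreg
  obtain ⟨hout, hnum⟩ := fills_spec hK (hasInput_graphInput G) hmem
  have hk : s.reg 0 = numLevels G := hreg.trans hnum
  have hlt : ∀ i : Fin (s.reg 0), (i : ℕ) < n ^ 2 := fun i => by
    obtain ⟨e, he⟩ := (lt_numLevels_iff hK).1 (i.2.trans_eq hk)
    exact he.lt hK fun _ h => h.lt
  refine ⟨t, s, hexec, ht, isOptimalBoxRepresentation_levels hco hca hk (fun i v => ?_)
    fun i v => ?_⟩
  · rw [leftEnd, mul_comm (i : ℕ), (hout i (hlt i) v).1]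
  · rw [rightEnd, mul_comm (i : ℕ), (hout i (hlt i) v).2]

end Boxicity

end Ram

theorem mainTheorem4 :
    -- structure: boxicity and the extension of colour classes
    (∀ (V : Type*) [Finite V] (G : SimpleGraph V), G.IsCoBipartite → G.IsCircularArcGraph →
      G.boxicity = Gᶜ.auxGraph.chromaticNumber ∧
      ∀ (k : ℕ), (k : ℕ∞) = Gᶜ.auxGraph.chromaticNumber →
        ∀ (c : Gᶜ.auxGraph.Coloring (Fin k)) (M : Fin k → Set Gᶜ.edgeSet),
          (∀ i, Maximal (fun S => Gᶜ.auxGraph.IsIndepSet S) (M i) ∧ c.colorClass i ⊆ M i) →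
          (∀ i, G ≤ Gᶜ.complOfEdges (M i)) ∧
          G.IsOptimalBoxRepresentation (fun i => Gᶜ.complOfEdges (M i))) ∧
    -- computability in polynomial time
    Ram.PolyTimeComputable (fun _ G => G.IsCoBipartite ∧ G.IsCircularArcGraph)
      Ram.OutputsBoxicity ∧
    Ram.PolyTimeComputable (fun _ G => G.IsCoBipartite ∧ G.IsCircularArcGraph)
      Ram.OutputsOptimalBoxRepresentation := by
  refine ⟨fun V _ G hco hca => ⟨SimpleGraph.boxicity_eq_chromaticNumber hco hca, fun k hk c M hM =>
    SimpleGraph.le_complOfEdges_and_isOptimalBoxRepresentation hco hca hk c M hM⟩, ?_,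
    Ram.Boxicity.exists_prog_isOptimalBoxRepresentation⟩
  obtain ⟨P, p, h⟩ := Ram.Boxicity.exists_prog_isOptimalBoxRepresentation
  refine ⟨P, p, fun n G hG => ?_⟩
  obtain ⟨t, s, hexec, ht, -, -, hbox⟩ := h n G hG
  exact ⟨t, s, hexec, ht, hbox⟩
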